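/- Let $n\ge 0$. For $w\in S_n$ let $\ell(w)=\#\{(i,j): i<j,\ w(i)>w(j)\}$, let $<$ denote the strong Bruhat order (the transitive closure of the relations $u<ut_{i,j}$ with $\ell(ut_{i,j})=\ell(u)+1$, where $t_{i,j}=(i\,j)$), and let $D(w)=\{(i,j)\in[n]^2 : w(i)>j,\ w^{-1}(j)>i\}$ be the Rothe diagram. A lower outside corner of $D(w)$ is a cell $(a,b)\in D(w)$ such that no other cell $(a',b')\in D(w)$ has $a'\ge a$ and $b'\ge b$. On $\mathbb Z[\beta][x_1,\dots,x_n,y_1,\dots,y_n]$ let $s_i=t_{i,i+1}$ act by exchanging $x_i$ and $x_{i+1}$, and put $$\pi_i(f)=\frac{(1+\beta x_{i+1})f-(1+\beta x_i)\,s_i\cdot f}{x_i-x_{i+1}},\qquad x_i\oplus y_j=x_i+y_j+\beta x_iy_j .$$ The $\beta$-double Grothendieck polynomials $\mathfrak G^{(\beta)}_w$, $w\in S_n$, are defined by $\mathfrak G^{(\beta)}_{w_0}=\prod_{i+j\le n}(x_i\oplus y_j)$ for $w_0=n\,(n-1)\cdots 1$ and $\mathfrak G^{(\beta)}_{ws_i}=\pi_i(\mathfrak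 G^{(\beta)}_w)$ whenever $w(i)>w(i+1)$. The double Schubert polynomials $\mathfrak S_w(\mathbf x,\mathbf y)\in\mathbb Z[\mathbf x,\mathbf y]$ are defined in the same way from $\mathfrak S_{w_0}=\prod_{i+j\le n}(x_i-y_j)$ and the divided differences $f\mapsto (f-s_i\cdot f)/(x_i-x_{i+1})$. The double Grothendieck polynomials are $\mathfrak G_w(\mathbf x,\mathbf y)=\mathfrak G^{(-1)}_w(\mathbf x,\mathbf y)\in\mathbb Z[\mathbf x,\mathbf y]$, and the single polynomials are $\mathfrak G_w(\mathbf x)=\mathfrak G_w(\mathbf x,\mathbf 0)$ and $\mathfrak S_w(\mathbf x)=\mathfrak S_w(\mathbf x,\mathbf 0)$. Then the polynomials $\mathfrak G^{(\beta)}_w$ are well defined. Moreover, let $w\in S_n$, let $(a,b)$ be a lower outside corner of $D(w)$, and set $v=w\,t_{a,w^{-1}(b)}$ and $$\phi=\phi(w,z_{a,b})=\{i\in[a-1] : vt_{i,a}>v,\ \ell(vt_{i,a})=\ell(v)+1\}.$$ For $U=\{i_1<\dots<i_k\}\subseteq\phi$ put $w_U=v\,(a\ i_k\ i_{k-1}\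 \dots\ i_1)$, the second factor being a cycle. Then $$\mathfrak G^{(\beta)}_w=(x_a\oplus y_b)\,\mathfrak G^{(\beta)}_v+\bigl(1+\beta(x_a\oplus y_b)\bigr)\sum_{\emptyset\ne U\subseteq\phi}\beta^{\#U-1}\,\mathfrak G^{(\beta)}_{w_U}.$$ Correspondingly, the double and single Grothendieck and Schubert polynomials satisfy $$\mathfrak G_w(\mathbf x,\mathbf y)=(x_a+y_b-x_ay_b)\,\mathfrak G_v(\mathbf x,\mathbf y)+\bigl(1-(x_a+y_b-x_ay_b)\bigr)\sum_{\emptyset\ne U\subseteq\phi}(-1)^{\#U-1}\mathfrak G_{w_U}(\mathbf x,\mathbf y),$$ $$\mathfrak G_w(\mathbf x)=x_a\,\mathfrak G_v(\mathbf x)+(1-x_a)\sum_{\emptyset\ne U\subseteq\phi}(-1)^{\#U-1}\mathfrak G_{w_U}(\mathbf x),$$ $$\mathfrak S_w(\mathbf x,\mathbf y)=(x_a-y_b)\,\mathfrak S_v(\mathbf x,\mathbf y)+\sum_{i\in\phi}\mathfrak S_{vt_{i,a}}(\mathbf x,\mathbf y),\qquad \mathfrak S_w(\mathbf x)=x_a\,\mathfrak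 S_v(\mathbf x)+\sum_{i\in\phi}\mathfrak S_{vt_{i,a}}(\mathbf x).$$ -/

import Mathlib

namespace MatrixSchubert

open Equiv MvPolynomial

/-! Permutations `w ∈ S_n` are elements of `Perm (Fin n)`; the letter `k ∈ {1, …, n}` is
represented by the element `k - 1` of `Fin n`.  Products are compositions,
`(u * w) i = u (w i)`. -/

/-- Coxeter length: the number of inversions. -/
def length {n : ℕ} (w : Perm (Fin n)) : ℕ :=
  (Finset.univ.filter fun p : Fin n × Fin n => p.1 < p.2 ∧ w p.2 < w p.1).card

/-- The covering relation of the strong Bruhat order. -/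
def BruhatCover {n : ℕ} (u w : Perm (Fin n)) : Prop :=
  ∃ i j : Fin n, w = u * swap i j ∧ length u + 1 = length w

/-- The strict strong Bruhat order: the transitive closure of the covering relations. -/
def BruhatLT {n : ℕ} (u w : Perm (Fin n)) : Prop :=
  Relation.TransGen BruhatCover u w

/-- The Rothe diagram `D(w)`. -/
def rotheDiagram {n : ℕ} (w : Perm (Fin n)) : Set (Fin n × Fin n) :=
  {p | p.2 < w p.1 ∧ p.1 < w⁻¹ p.2}

/-- A lower outside corner of `D(w)`: a cell of `D(w)` with no other cell of `D(w)` weakly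
southeast of it (`≤` on pairs is componentwise). -/
def IsLowerOutsideCorner {n : ℕ} (w : Perm (Fin n)) (a b : Fin n) : Prop :=
  Maximal (· ∈ rotheDiagram w) (a, b)

/-- The permutation `v = w t_{a, w⁻¹(b)}`. -/
def cornerPerm {n : ℕ} (w : Perm (Fin n)) (a b : Fin n) : Perm (Fin n) :=
  w * swap a (w⁻¹ b)

open Classical in
/-- The set `φ(w, z_{a,b})`. -/
noncomputable def phi {n : ℕ} (w : Perm (Fin n)) (a b : Fin n) : Finset (Fin n) :=
  Finset.univ.filter fun i => i < a ∧
    BruhatLT (cornerPerm w a b) (cornerPerm w a b * swap i a) ∧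
    length (cornerPerm w a b * swap i a) = length (cornerPerm w a b) + 1

/-- For `U = {i₁ < ⋯ < i_k}`, the permutation `w_U = v (a i_k i_{k-1} … i₁)`, where the second
factor is the cycle `a ↦ i_k ↦ i_{k-1} ↦ ⋯ ↦ i₁ ↦ a`. -/
def cyclePerm {n : ℕ} (w : Perm (Fin n)) (a b : Fin n) (U : Finset (Fin n)) : Perm (Fin n) :=
  cornerPerm w a b * (a :: U.sort (· ≥ ·)).formPerm

section Polynomials

variable {R : Type*} [CommRing R] {n : ℕ}

/-- The variable `x_i`. -/
noncomputable def x (i : Fin n) : MvPolynomial (Fin n ⊕ Fin n) R := X (Sum.inl i)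

/-- The variable `y_j`. -/
noncomputable def y (j : Fin n) : MvPolynomial (Fin n ⊕ Fin n) R := X (Sum.inr j)

/-- `x_i ⊕ y_j = x_i + y_j + β x_i y_j`. -/
noncomputable def oplus (β : R) (i j : Fin n) : MvPolynomial (Fin n ⊕ Fin n) R :=
  x i + y j + C β * x i * y j

/-- `S_n` acts on polynomials by permuting the variables `x_1, …, x_n` only. -/
noncomputable def actX (w : Perm (Fin n)) (f : MvPolynomial (Fin n ⊕ Fin n) R) :
    MvPolynomial (Fin n ⊕ Fin n) R :=
  rename (Sum.map w id) f

theorem x_sub_x_dvd_sub_actX (i j : Fin n) (f : MvPolynomial (Fin n ⊕ Fin n) R) :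
    x i - x j ∣ f - actX (swap i j) f := by
  induction f using MvPolynomial.induction_on with
  | C r => simp [actX]
  | add p q hp hq =>
    have h : p + q - actX (swap i j) (p + q) =
        (p - actX (swap i j) p) + (q - actX (swap i j) q) := by
      simp only [actX, map_add]; ring
    rw [h]; exact dvd_add hp hq
  | mul_X p k hp =>
    have hk : (x i - x j : MvPolynomial (Fin n ⊕ Fin n) R) ∣
        X k - X (Sum.map (swap i j) id k) := by
      rcases k with k | k
      · by_cases h1 : k = i
        · subst h1; simp [x]
        · by_cases h2 : k = j
          · subst h2
            simp only [Sum.map_inl, swap_apply_right, x]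
            exact ⟨-1, by ring⟩
          · simp [swap_apply_of_ne_of_ne h1 h2]
      · simp
    have h : p * X k - actX (swap i j) (p * X k) =
        (p - actX (swap i j) p) * X k +
          actX (swap i j) p * (X k - X (Sum.map (swap i j) id k)) := by
      simp only [actX, map_mul, rename_X]; ring
    rw [h]; exact dvd_add (Dvd.dvd.mul_right hp _) (Dvd.dvd.mul_left hk _)

theorem x_sub_x_dvd (β : R) (i j : Fin n) (f : MvPolynomial (Fin n ⊕ Fin n) R) :
    x i - x j ∣ (1 + C β * x j) * f - (1 + C β * x i) * actX (swap i j) f := by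
  have h : (1 + C β * x j) * f - (1 + C β * x i) * actX (swap i j) f =
      (1 + C β * x j) * (f - actX (swap i j) f) +
        (x i - x j) * (-(C β * actX (swap i j) f)) := by ring
  rw [h]
  exact dvd_add (Dvd.dvd.mul_left (x_sub_x_dvd_sub_actX i j f) _) (dvd_mul_right _ _)

/-- The operator
`π f = ((1 + β x_j) f - (1 + β x_i) (s · f)) / (x_i - x_j)`, `s` the transposition of `i` and `j`;
it is used for `j = i + 1`.  For `β = 0` it is the divided difference operator. -/
noncomputable def demazure (β : R) (i j : Fin n) (f : MvPolynomial (Fin n ⊕ Fin n) R) :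
    MvPolynomial (Fin n ⊕ Fin n) R :=
  (x_sub_x_dvd β i j f).choose

theorem x_sub_x_mul_demazure (β : R) (i j : Fin n) (f : MvPolynomial (Fin n ⊕ Fin n) R) :
    (x i - x j) * demazure β i j f =
      (1 + C β * x j) * f - (1 + C β * x i) * actX (swap i j) f :=
  (x_sub_x_dvd β i j f).choose_spec.symm

/-- `w` has an ascent at the adjacent positions `p.1`, `p.2`. -/
def IsAscent (w : Perm (Fin n)) (p : Fin n × Fin n) : Prop :=
  (p.1 : ℕ) + 1 = p.2 ∧ w p.1 < w p.2

theorem sum_mul_swap_lt (w : Perm (Fin n)) (p : Fin n × Fin n) (h : IsAscent w p) :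
    ∑ k : Fin n, (k : ℕ) * ((w * swap p.1 p.2) k : ℕ) < ∑ k : Fin n, (k : ℕ) * (w k : ℕ) := by
  obtain ⟨i, j⟩ := p
  obtain ⟨h1, h2⟩ := h
  simp only at h1 h2
  have hij : i ≠ j := by intro h; subst h; omega
  have hw : (w i : ℕ) < w j := h2
  rw [← Finset.add_sum_erase _ _ (Finset.mem_univ i),
    ← Finset.add_sum_erase (a := i) Finset.univ (fun k : Fin n => (k : ℕ) * (w k : ℕ))
      (Finset.mem_univ i)]
  have hj : j ∈ Finset.univ.erase i := by simp [hij.symm]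
  rw [← Finset.add_sum_erase _ _ hj,
    ← Finset.add_sum_erase (a := j) (Finset.univ.erase i) (fun k : Fin n => (k : ℕ) * (w k : ℕ))
      hj]
  have hrest : ∑ k ∈ (Finset.univ.erase i).erase j, (k : ℕ) * ((w * swap i j) k : ℕ) =
      ∑ k ∈ (Finset.univ.erase i).erase j, (k : ℕ) * (w k : ℕ) := by
    refine Finset.sum_congr rfl fun k hk => ?_
    simp only [Finset.mem_erase, Finset.mem_univ, and_true] at hk
    rw [Perm.mul_apply, swap_apply_of_ne_of_ne hk.2 hk.1]
  simp only [Perm.mul_apply, swap_apply_left, swap_apply_right] at hrest ⊢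
  rw [hrest, ← h1]
  nlinarith

open Classical in
/-- The polynomials obtained from the polynomial `top` of the longest permutation by descending:
if `w` has an ascent at `(i, i + 1)`, then `w s_i` has a descent there and `w = (w s_i) s_i`, and
the polynomial of `w` is `π_i` applied to that of `w s_i`.  The only permutation without ascents
is the longest one. -/
noncomputable def descend (β : R) (top : MvPolynomial (Fin n ⊕ Fin n) R) (w : Perm (Fin n)) :
    MvPolynomial (Fin n ⊕ Fin n) R :=
  if h : ∃ p : Fin n × Fin n, IsAscent w p then
    demazure β h.choose.1 h.choose.2 (descend β top (w * swap h.choose.1 h.choose.2))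
  else top
termination_by ∑ k : Fin n, (k : ℕ) * (w k : ℕ)
decreasing_by exact sum_mul_swap_lt w _ h.choose_spec

/-- The `β`-double Grothendieck polynomial of `w`.  In the product `i` and `j` are numbered from
`0`, so the condition `i + j ≤ n` of the numbering from `1` reads `i + j + 2 ≤ n`. -/
noncomputable def grothendieck (β : R) (w : Perm (Fin n)) : MvPolynomial (Fin n ⊕ Fin n) R :=
  descend β
    (∏ p ∈ Finset.univ.filter (fun p : Fin n × Fin n => (p.1 : ℕ) + p.2 + 2 ≤ n), oplus β p.1 p.2)
    w

/-- The double Schubert polynomial of `w`: divided differences (`β = 0`) of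
`∏_{i + j ≤ n} (x_i - y_j)`. -/
noncomputable def doubleSchubert (w : Perm (Fin n)) : MvPolynomial (Fin n ⊕ Fin n) R :=
  descend 0
    (∏ p ∈ Finset.univ.filter (fun p : Fin n × Fin n => (p.1 : ℕ) + p.2 + 2 ≤ n), (x p.1 - y p.2))
    w

/-- The specialization `y_1 = ⋯ = y_n = 0`. -/
noncomputable def single :
    MvPolynomial (Fin n ⊕ Fin n) R →ₐ[R] MvPolynomial (Fin n) R :=
  aeval (Sum.elim X (fun _ => 0))

end Polynomials

end MatrixSchubert

open MatrixSchubert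

namespace MatrixSchubert

open Equiv MvPolynomial

/-! Write `T(u, a) = ∑ β^#U G_{u (a i_k … i_1)}`, the sum over all sets `U` of positions left of `a`
whose exchange with `a` covers `u` (`transitionSum`). Since `1 + β (x ⊕ y) = (1 + β x)(1 + β y)`,
the transition formula multiplied by `β` takes the multiplicative form `G_v + β G_{v t_{a,d}} = (1 +
β x_a)(1 + β y_{v(a)}) T(v, a)`, with `d = w⁻¹(b)`, and `β` can be cancelled in a domain when it is
nonzero.

This form is stable under the operators `π_i`. If `u` has a descent at `i`, then `π_i T(u, a) = T(u
s_i, a)` for `s_i` acting on positions all left of `a` (`demazure_transitionSum`) or all right of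
`a` (`demazure_transitionSum_of_gt`). If `u(a-1) < u(a)`, then `(π + β) T(u s, a-1) = T(u, a)` for
the operator and exchange at `(a-1, a)` (`demazure_add_transitionSum`); the same `π + β` comes out
of the Leibniz rule for the factor `1 + β x_{a-1}`. So the identity for `v s_i`, which is closer to
the longest element, gives the identity for `v`.

The induction runs over the configurations `IsTransition`, a property of `v` at a corner that
survives these moves. It stops when none of the ascents it uses remains. Then `v` is dominant, `d =
a + 1`, no position covers, and both Grothendieck polynomials are explicit products differing by the
single factor `x_a ⊕ y_{v(a)}`.

Well-definedness is the usual consequence of the commutation and braid relations of the `π_i`. The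
Schubert formulas are the image of the formula over `ℤ[β]` under `β = 0`, `y ↦ -y`, where only
one-element sets `U` survive. -/

theorem swap_mul_swap_comm {α : Type*} [DecidableEq α] {i j k l : α} (hik : i ≠ k) (hil : i ≠ l)
    (hjk : j ≠ k) (hjl : j ≠ l) : swap i j * swap k l = swap k l * swap i j := by
  have h := swap_mul_eq_mul_swap (swap i j) k l
  rwa [swap_inv, swap_apply_of_ne_of_ne hik.symm hjk.symm,
    swap_apply_of_ne_of_ne hil.symm hjl.symm, eq_comm] at h

/-- Conjugation of a transposition by a transposition sharing one letter. -/
theorem swap_mul_swap_eq {α : Type*} [DecidableEq α] {i j k : α} (hik : i ≠ k)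
    (hjk : j ≠ k) : swap i j * swap j k = swap i k * swap i j := by
  have h := mul_swap_eq_swap_mul (swap i j) j k
  rwa [swap_apply_right, swap_apply_of_ne_of_ne hik.symm hjk.symm] at h

theorem swap_mul_swap_braid {α : Type*} [DecidableEq α] {i j k : α} (hij : i ≠ j) (hik : i ≠ k)
    (hjk : j ≠ k) :
    swap i j * (swap j k * swap i j) = swap j k * (swap i j * swap j k) := by
  have h := swap_mul_swap_mul_swap hij hik
  have h' := swap_mul_swap_mul_swap hjk.symm hik.symm
  rw [swap_comm k j, swap_comm j i] at h'
  rw [← mul_assoc, ← mul_assoc, h, h', swap_comm]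

/-! ### Relations among the operators `π_i`, and well-definedness of the recursion. -/

section Operators

variable {R : Type*} [CommRing R] {n : ℕ}

theorem actX_mul_apply (u w : Perm (Fin n)) (f : MvPolynomial (Fin n ⊕ Fin n) R) :
    actX (u * w) f = actX u (actX w f) := by
  simp only [actX, rename_rename]
  congr 1
  ext k
  rcases k with k | k <;> simp

@[simp] theorem actX_add (w : Perm (Fin n)) (f g : MvPolynomial (Fin n ⊕ Fin n) R) :
    actX w (f + g) = actX w f + actX w g := map_add _ _ _

@[simp] theorem actX_sub (w : Perm (Fin n)) (f g : MvPolynomial (Fin n ⊕ Fin n) R) :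
    actX w (f - g) = actX w f - actX w g := map_sub _ _ _

@[simp] theorem actX_mul (w : Perm (Fin n)) (f g : MvPolynomial (Fin n ⊕ Fin n) R) :
    actX w (f * g) = actX w f * actX w g := map_mul _ _ _

@[simp] theorem actX_one (w : Perm (Fin n)) :
    actX w (1 : MvPolynomial (Fin n ⊕ Fin n) R) = 1 := map_one _

@[simp] theorem actX_C (w : Perm (Fin n)) (r : R) :
    actX w (C r : MvPolynomial (Fin n ⊕ Fin n) R) = C r := rename_C _ _

@[simp] theorem actX_x (w : Perm (Fin n)) (i : Fin n) :
    actX w (x i : MvPolynomial (Fin n ⊕ Fin n) R) = x (w i) := by simp [actX, x]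

@[simp] theorem actX_y (w : Perm (Fin n)) (i : Fin n) :
    actX w (y i : MvPolynomial (Fin n ⊕ Fin n) R) = y i := by simp [actX, y]

@[simp] theorem actX_swap_swap (i j : Fin n) (f : MvPolynomial (Fin n ⊕ Fin n) R) :
    actX (swap i j) (actX (swap i j) f) = f := by
  rw [← actX_mul_apply, swap_mul_self]
  simp [actX]

variable [IsDomain R]

theorem x_sub_x_ne_zero {i j : Fin n} (h : i ≠ j) :
    (x i - x j : MvPolynomial (Fin n ⊕ Fin n) R) ≠ 0 := by
  rw [sub_ne_zero]
  intro h'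
  exact h (Sum.inl_injective (X_injective h'))

variable (β : R)

/-- The operator is a chosen quotient; in a domain the defining equation determines it, so every
identity below is checked after multiplying by `x_i - x_j`. -/
theorem demazure_eq_of_mul_eq {i j : Fin n} (hij : i ≠ j) {f g : MvPolynomial (Fin n ⊕ Fin n) R}
    (h : (x i - x j) * g = (1 + C β * x j) * f - (1 + C β * x i) * actX (swap i j) f) :
    demazure β i j f = g :=
  mul_left_cancel₀ (x_sub_x_ne_zero hij) ((x_sub_x_mul_demazure β i j f).trans h.symm)

theorem demazure_add {i j : Fin n} (hij : i ≠ j) (f g : MvPolynomial (Fin n ⊕ Fin n) R) :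
    demazure β i j (f + g) = demazure β i j f + demazure β i j g := by
  apply demazure_eq_of_mul_eq β hij
  rw [actX_add]
  linear_combination x_sub_x_mul_demazure β i j f + x_sub_x_mul_demazure β i j g

/-- Multiplication by a polynomial that is symmetric in the two variables commutes with the
operator. -/
theorem demazure_mul_of_actX_eq {i j : Fin n} (hij : i ≠ j)
    {f : MvPolynomial (Fin n ⊕ Fin n) R} (hf : actX (swap i j) f = f)
    (g : MvPolynomial (Fin n ⊕ Fin n) R) :
    demazure β i j (f * g) = f * demazure β i j g := by
  apply demazure_eq_of_mul_eq β hij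
  rw [actX_mul, hf]
  linear_combination f * x_sub_x_mul_demazure β i j g

/-- The exchange negates both numerator and denominator. -/
theorem actX_demazure {i j : Fin n} (hij : i ≠ j) (f : MvPolynomial (Fin n ⊕ Fin n) R) :
    actX (swap i j) (demazure β i j f) = demazure β i j f := by
  symm
  apply demazure_eq_of_mul_eq β hij
  have h := congrArg (actX (swap i j)) (x_sub_x_mul_demazure β i j f)
  simp only [actX_mul, actX_sub, actX_add, actX_one, actX_C, actX_x, swap_apply_left,
    swap_apply_right, actX_swap_swap] at h
  linear_combination -h

/-- The value `π f` is symmetric in the two variables, so the numerator of `π (π f)` is `β (x_j -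
x_i) π f`. -/
theorem demazure_demazure {i j : Fin n} (hij : i ≠ j) (f : MvPolynomial (Fin n ⊕ Fin n) R) :
    demazure β i j (demazure β i j f) = -(C β * demazure β i j f) := by
  apply demazure_eq_of_mul_eq β hij
  rw [actX_demazure β hij]
  ring

/-- The twisted Leibniz rule for the factor `1 + β x_i`. -/
theorem demazure_one_add_mul {i j : Fin n} (hij : i ≠ j) (f : MvPolynomial (Fin n ⊕ Fin n) R) :
    demazure β i j ((1 + C β * x i) * f) =
      (1 + C β * x j) * (demazure β i j f + C β * f) := by
  apply demazure_eq_of_mul_eq β hij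
  simp only [actX_mul, actX_add, actX_one, actX_C, actX_x, swap_apply_left]
  linear_combination (1 + C β * x j) * x_sub_x_mul_demazure β i j f

theorem demazure_oplus {i j : Fin n} (hij : i ≠ j) (k : Fin n) :
    demazure β i j (oplus β i k) = 1 := by
  apply demazure_eq_of_mul_eq β hij
  simp only [oplus, actX_mul, actX_add, actX_C, actX_x, actX_y, swap_apply_left]
  ring

theorem demazure_comm {i j k l : Fin n} (hij : i ≠ j) (hkl : k ≠ l) (hik : i ≠ k) (hil : i ≠ l)
    (hjk : j ≠ k) (hjl : j ≠ l) (f : MvPolynomial (Fin n ⊕ Fin n) R) :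
    demazure β i j (demazure β k l f) = demazure β k l (demazure β i j f) := by
  apply demazure_eq_of_mul_eq β hij
  apply mul_left_cancel₀ (x_sub_x_ne_zero (R := R) hkl)
  have h1 := x_sub_x_mul_demazure β k l (demazure β i j f)
  have h2 := x_sub_x_mul_demazure β k l f
  have h3 := congrArg (actX (swap i j)) h2
  have h4 := x_sub_x_mul_demazure β i j f
  have h5 := congrArg (actX (swap k l)) h4
  have hc : actX (swap i j) (actX (swap k l) f) = actX (swap k l) (actX (swap i j) f) := by
    rw [← actX_mul_apply, ← actX_mul_apply,
      swap_mul_swap_comm hik hil hjk hjl]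
  simp only [actX_mul, actX_sub, actX_add, actX_one, actX_C, actX_x,
    swap_apply_of_ne_of_ne hik.symm hjk.symm, swap_apply_of_ne_of_ne hil.symm hjl.symm,
    swap_apply_of_ne_of_ne hik hil, swap_apply_of_ne_of_ne hjk hjl] at h3 h5
  rw [hc] at h3
  linear_combination (x i - x j) * h1 + (1 + C β * x l) * h4 - (1 + C β * x k) * h5
    - (1 + C β * x j) * h2 + (1 + C β * x i) * h3

/-- The full expansion of the product of three operators, symmetric under the braid relation. -/
theorem mul_demazure_demazure_demazure {i j k : Fin n} (hij : i ≠ j) (hik : i ≠ k) (hjk : j ≠ k)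
    (f : MvPolynomial (Fin n ⊕ Fin n) R) :
    (x i - x j) * (x i - x k) * (x j - x k) *
      demazure β i j (demazure β j k (demazure β i j f)) =
    (1 + C β * x j) * (1 + C β * x k) ^ 2 * f
      - (1 + C β * x i) * (1 + C β * x k) ^ 2 * actX (swap i j) f
      - (1 + C β * x j) ^ 2 * (1 + C β * x k) * actX (swap j k) f
      + (1 + C β * x i) * (1 + C β * x j) ^ 2 * actX (swap j k) (actX (swap i j) f)
      + (1 + C β * x i) ^ 2 * (1 + C β * x k) * actX (swap i j) (actX (swap j k) f)
      - (1 + C β * x i) ^ 2 * (1 + C β * x j) *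
        actX (swap i j) (actX (swap j k) (actX (swap i j) f)) := by
  have h1 := x_sub_x_mul_demazure β i j f
  have h2 := x_sub_x_mul_demazure β j k (demazure β i j f)
  have h3 := x_sub_x_mul_demazure β i j (demazure β j k (demazure β i j f))
  have h1t := congrArg (actX (swap j k)) h1
  have h2s := congrArg (actX (swap i j)) h2
  have h1st := congrArg (actX (swap i j)) h1t
  simp only [actX_mul, actX_sub, actX_add, actX_one, actX_C, actX_x, swap_apply_left,
    swap_apply_right, swap_apply_of_ne_of_ne hij hik, swap_apply_of_ne_of_ne hik.symm hjk.symm,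
    actX_demazure β hij] at h1t h2s h1st
  apply mul_left_cancel₀ (x_sub_x_ne_zero (R := R) hij)
  linear_combination ((x i - x j) * (x i - x k) * (x j - x k)) * h3
    + (x i - x j) * (x i - x k) * (1 + C β * x j) * h2
    - (x i - x j) * (x j - x k) * (1 + C β * x i) * h2s
    + (x i - x k) * (1 + C β * x j) * (1 + C β * x k) * h1
    - (x i - x j) * (1 + C β * x j) ^ 2 * h1t
    - (x j - x k) * (1 + C β * x i) * (1 + C β * x k) * h1
    + (x i - x j) * (1 + C β * x i) ^ 2 * h1st

/-- The right side differs from that of `mul_demazure_demazure_demazure` only in the last term,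
where the two words in transpositions are equal by the braid relation in the symmetric group. -/
theorem mul_demazure_demazure_demazure' {i j k : Fin n} (hij : i ≠ j) (hik : i ≠ k) (hjk : j ≠ k)
    (f : MvPolynomial (Fin n ⊕ Fin n) R) :
    (x i - x j) * (x i - x k) * (x j - x k) *
      demazure β j k (demazure β i j (demazure β j k f)) =
    (1 + C β * x j) * (1 + C β * x k) ^ 2 * f
      - (1 + C β * x i) * (1 + C β * x k) ^ 2 * actX (swap i j) f
      - (1 + C β * x j) ^ 2 * (1 + C β * x k) * actX (swap j k) f
      + (1 + C β * x i) * (1 + C β * x j) ^ 2 * actX (swap j k) (actX (swap i j) f)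
      + (1 + C β * x i) ^ 2 * (1 + C β * x k) * actX (swap i j) (actX (swap j k) f)
      - (1 + C β * x i) ^ 2 * (1 + C β * x j) *
        actX (swap j k) (actX (swap i j) (actX (swap j k) f)) := by
  have h1 := x_sub_x_mul_demazure β j k f
  have h2 := x_sub_x_mul_demazure β i j (demazure β j k f)
  have h3 := x_sub_x_mul_demazure β j k (demazure β i j (demazure β j k f))
  have h1s := congrArg (actX (swap i j)) h1
  have h2t := congrArg (actX (swap j k)) h2
  have h1ts := congrArg (actX (swap j k)) h1s
  simp only [actX_mul, actX_sub, actX_add, actX_one, actX_C, actX_x, swap_apply_left,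
    swap_apply_right, swap_apply_of_ne_of_ne hij hik, swap_apply_of_ne_of_ne hik.symm hjk.symm,
    actX_demazure β hjk] at h1s h2t h1ts
  apply mul_left_cancel₀ (x_sub_x_ne_zero (R := R) hjk)
  linear_combination ((x i - x j) * (x i - x k) * (x j - x k)) * h3
    + (x j - x k) * (x i - x k) * (1 + C β * x k) * h2
    - (x i - x j) * (x j - x k) * (1 + C β * x j) * h2t
    + (x i - x k) * (1 + C β * x j) * (1 + C β * x k) * h1
    - (x j - x k) * (1 + C β * x i) * (1 + C β * x k) * h1s
    - (x i - x j) * (1 + C β * x j) * (1 + C β * x k) * h1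
    + (x j - x k) * (1 + C β * x i) * (1 + C β * x j) * h1ts

/-- The braid relation. -/
theorem demazure_braid {i j k : Fin n} (hij : i ≠ j) (hik : i ≠ k) (hjk : j ≠ k)
    (f : MvPolynomial (Fin n ⊕ Fin n) R) :
    demazure β i j (demazure β j k (demazure β i j f)) =
      demazure β j k (demazure β i j (demazure β j k f)) := by
  apply mul_left_cancel₀ (mul_ne_zero (mul_ne_zero (x_sub_x_ne_zero (R := R) hij)
    (x_sub_x_ne_zero hik)) (x_sub_x_ne_zero hjk))
  rw [mul_demazure_demazure_demazure β hij hik hjk, mul_demazure_demazure_demazure' β hij hik hjk]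
  simp only [← actX_mul_apply]
  rw [swap_mul_swap_braid hij hik hjk]

/-- The recursion defining `descend` holds at every ascent, not only at the chosen one. -/
theorem descend_eq_demazure (top : MvPolynomial (Fin n ⊕ Fin n) R) (w : Perm (Fin n))
    (p : Fin n × Fin n) (hp : IsAscent w p) :
    descend β top w = demazure β p.1 p.2 (descend β top (w * swap p.1 p.2)) := by
  induction hN : ∑ k : Fin n, (k : ℕ) * (w k : ℕ) using Nat.strong_induction_on
    generalizing w p with
  | _ N ih =>
  subst hN
  have hex : ∃ q : Fin n × Fin n, IsAscent w q := ⟨p, hp⟩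
  rw [descend, dif_pos hex]
  -- Nothing is used about the chosen ascent `q` except that it is an ascent; it is compared with
  -- the given `p`.
  generalize hex.choose = q, hex.choose_spec = hq
  obtain ⟨i, j⟩ := p
  obtain ⟨k, l⟩ := q
  have ih1 : ∀ p q, IsAscent w p → IsAscent (w * swap p.1 p.2) q →
      descend β top (w * swap p.1 p.2) =
        demazure β q.1 q.2 (descend β top (w * swap p.1 p.2 * swap q.1 q.2)) :=
    fun p q hp hq => ih _ (sum_mul_swap_lt w p hp) _ q hq rfl
  have ih2 : ∀ p q r, IsAscent w p → IsAscent (w * swap p.1 p.2) q →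
      IsAscent (w * swap p.1 p.2 * swap q.1 q.2) r →
      descend β top (w * swap p.1 p.2 * swap q.1 q.2) =
        demazure β r.1 r.2 (descend β top (w * swap p.1 p.2 * swap q.1 q.2 * swap r.1 r.2)) :=
    fun p q r hp hq hr =>
      ih _ ((sum_mul_swap_lt _ q hq).trans (sum_mul_swap_lt w p hp)) _ r hr rfl
  -- Ascents sharing a position: both sides are continued by two more ascents to the permutation
  -- with the three entries reversed, where the braid relation identifies them.
  have braid : ∀ i j k : Fin n, IsAscent w (i, j) → IsAscent w (j, k) →
      demazure β i j (descend β top (w * swap i j)) =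
        demazure β j k (descend β top (w * swap j k)) := by
    rintro i j k ⟨h1, h2⟩ ⟨h3, h4⟩
    simp only at h1 h2 h3 h4
    have hij : i ≠ j := by rintro rfl; omega
    have hjk : j ≠ k := by rintro rfl; omega
    have hik : i ≠ k := by rintro rfl; omega
    have e1 : swap i j k = k := swap_apply_of_ne_of_ne hik.symm hjk.symm
    have e2 : swap j k i = i := swap_apply_of_ne_of_ne hij hik
    rw [ih1 (i, j) (j, k) ⟨h1, h2⟩ ⟨h3, by simpa [e1] using h2.trans h4⟩,
      ih2 (i, j) (j, k) (i, j) ⟨h1, h2⟩ ⟨h3, by simpa [e1] using h2.trans h4⟩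
        ⟨h1, by simpa [e1, e2] using h4⟩,
      ih1 (j, k) (i, j) ⟨h3, h4⟩ ⟨h1, by simpa [e2] using h2.trans h4⟩,
      ih2 (j, k) (i, j) (j, k) ⟨h3, h4⟩ ⟨h1, by simpa [e2] using h2.trans h4⟩
        ⟨h3, by simpa [e1, e2] using h2⟩]
    simp only
    rw [demazure_braid β hij hik hjk, mul_assoc w, mul_assoc w, mul_assoc w, mul_assoc w,
      mul_assoc (swap i j), mul_assoc (swap j k),
      swap_mul_swap_braid hij hik hjk]
  obtain ⟨h1, h2⟩ := id hp
  obtain ⟨h3, h4⟩ := id hq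
  simp only at h1 h2 h3 h4 ⊢
  by_cases hki : k = i
  · subst hki
    obtain rfl : l = j := by ext; omega
    rfl
  by_cases hli : l = i
  · subst hli
    exact braid k l j hq hp
  by_cases hkj : k = j
  · subst hkj
    exact (braid i k l hp hq).symm
  have hlj : l ≠ j := by rintro rfl; apply hki; ext; omega
  have hij : i ≠ j := by rintro rfl; omega
  have hkl : k ≠ l := by rintro rfl; omega
  -- The remaining case is that of disjoint ascents: each persists after the other exchange, and the
  -- operators commute.
  have e : swap i j * swap k l = swap k l * swap i j :=
    swap_mul_swap_comm (Ne.symm hki) (Ne.symm hli) (Ne.symm hkj) hlj.symm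
  rw [ih1 (k, l) (i, j) hq ⟨h1, by
      simpa [swap_apply_of_ne_of_ne (Ne.symm hki) (Ne.symm hli),
        swap_apply_of_ne_of_ne (Ne.symm hkj) hlj.symm] using h2⟩,
    ih1 (i, j) (k, l) hp ⟨h3, by
      simpa [swap_apply_of_ne_of_ne hki hkj, swap_apply_of_ne_of_ne hli hlj] using h4⟩]
  simp only
  rw [demazure_comm β hkl hij hki hkj hli hlj, mul_assoc, mul_assoc, e]

end Operators

/-! ### Length and the covering relation of the Bruhat order. -/

section Length

variable {n : ℕ}

theorem sum_sum_eq_add_of_ne {i a : Fin n} (hia : i ≠ a) (f : Fin n → Fin n → ℕ) :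
    ∑ p, ∑ q, f p q = f i i + f i a + f a i + f a a +
      ∑ l ∈ (Finset.univ.erase i).erase a, (f i l + f l i + f a l + f l a) +
      ∑ l ∈ (Finset.univ.erase i).erase a, ∑ m ∈ (Finset.univ.erase i).erase a, f l m := by
  have key : ∀ g : Fin n → ℕ, ∑ p, g p = g i + (g a +
      ∑ l ∈ (Finset.univ.erase i).erase a, g l) := fun g => by
    rw [Finset.add_sum_erase _ g (by simp [hia.symm]), Finset.add_sum_erase _ g (by simp)]
  simp only [key, Finset.sum_add_distrib]
  ring

theorem length_eq_sum (u : Perm (Fin n)) :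
    length u = ∑ p, ∑ q, if p < q ∧ u q < u p then 1 else 0 := by
  rw [length, Finset.card_filter, Fintype.sum_prod_type]

/-- Exchanging the increasing entries in positions `i < a` raises the length by one plus twice the
number of entries between them, in position and in value. -/
theorem length_mul_swap {u : Perm (Fin n)} {i a : Fin n} (hia : i < a) (hu : u i < u a) :
    length (u * swap i a) = length u + 1 +
      2 * ∑ l ∈ (Finset.univ.erase i).erase a,
        if (i < l ∧ l < a) ∧ u i < u l ∧ u l < u a then 1 else 0 := by
  have hrest : ∀ l ∈ (Finset.univ.erase i).erase a, (u * swap i a) l = u l := by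
    intro l hl
    simp only [Finset.mem_erase, Finset.mem_univ, and_true] at hl
    simp [swap_apply_of_ne_of_ne hl.2 hl.1]
  have hi : (u * swap i a) i = u a := by simp
  have ha : (u * swap i a) a = u i := by simp
  rw [length_eq_sum, length_eq_sum, sum_sum_eq_add_of_ne hia.ne, sum_sum_eq_add_of_ne hia.ne,
    hi, ha]
  have h1 : ∑ l ∈ (Finset.univ.erase i).erase a, ∑ m ∈ (Finset.univ.erase i).erase a,
      (if l < m ∧ (u * swap i a) m < (u * swap i a) l then 1 else 0) =
      ∑ l ∈ (Finset.univ.erase i).erase a, ∑ m ∈ (Finset.univ.erase i).erase a,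
      (if l < m ∧ u m < u l then 1 else 0) :=
    Finset.sum_congr rfl fun l hl => Finset.sum_congr rfl fun m hm => by
      rw [hrest l hl, hrest m hm]
  rw [h1, Finset.mul_sum]
  -- The pairs formed by a third position `l` with `i` and `a` contribute the same before and after,
  -- unless `l` lies in the box between the two entries, where two inversions are gained.
  have h2 : ∀ l ∈ (Finset.univ.erase i).erase a,
      ((((if i < l ∧ (u * swap i a) l < u a then 1 else 0) +
        (if l < i ∧ u a < (u * swap i a) l then 1 else 0)) +
        (if a < l ∧ (u * swap i a) l < u i then 1 else 0)) +
        (if l < a ∧ u i < (u * swap i a) l then 1 else 0)) =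
      ((((if i < l ∧ u l < u i then 1 else 0) +
        (if l < i ∧ u i < u l then 1 else 0)) +
        (if a < l ∧ u l < u a then 1 else 0)) +
        (if l < a ∧ u a < u l then 1 else 0)) +
      2 * (if (i < l ∧ l < a) ∧ u i < u l ∧ u l < u a then 1 else 0) := by
    intro l hl
    rw [hrest l hl]
    simp only [Finset.mem_erase, Finset.mem_univ, and_true] at hl
    have e1 : u l ≠ u i := fun h => hl.2 (u.injective h)
    have e2 : u l ≠ u a := fun h => hl.1 (u.injective h)
    have e3 := hl.1
    have e4 := hl.2
    clear h1 hrest hi ha hl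
    generalize u l = p at *
    generalize u i = q at *
    generalize u a = r at *
    rcases lt_or_gt_of_ne e1 with e1 | e1 <;> rcases lt_or_gt_of_ne e2 with e2 | e2 <;>
    rcases lt_or_gt_of_ne e3 with e3 | e3 <;> rcases lt_or_gt_of_ne e4 with e4 | e4 <;>
    first
    | exact absurd (e1.trans (hu.trans e2)) (lt_irrefl _)
    | exact absurd (e4.trans (hia.trans e3)) (lt_irrefl _)
    | simp [e1, e2, e3, e4, e1.not_gt, e2.not_gt, e3.not_gt, e4.not_gt]
  rw [Finset.sum_congr rfl h2, Finset.sum_add_distrib]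
  simp only [lt_self_iff_false, false_and, if_false, hia, hu, hia.not_gt, hu.not_gt, and_false,
    and_self, if_true]
  ring

/-- The transposition of the positions `l` and `a` gives a cover of `u` in the Bruhat order, for
`l < a`. -/
def IsCover (u : Perm (Fin n)) (l a : Fin n) : Prop :=
  u l < u a ∧ ∀ m, l < m → m < a → u l < u m → ¬ u m < u a

theorem length_mul_swap_eq_iff {u : Perm (Fin n)} {i a : Fin n} (hia : i < a) :
    length (u * swap i a) = length u + 1 ↔ IsCover u i a := by
  rcases lt_or_gt_of_ne (fun h => hia.ne (u.injective h) : u i ≠ u a) with hu | hu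
  · rw [length_mul_swap hia hu]
    simp only [Nat.add_eq_left, mul_eq_zero, OfNat.ofNat_ne_zero, false_or, Finset.sum_eq_zero_iff,
      Finset.mem_erase, Finset.mem_univ, and_true, IsCover, hu, true_and, ite_eq_right_iff,
      one_ne_zero, imp_false]
    exact ⟨fun h m h1 h2 h3 h4 => h m ⟨h2.ne, h1.ne'⟩ ⟨⟨h1, h2⟩, h3, h4⟩,
      fun h m _ h1 => h m h1.1.1 h1.1.2 h1.2.1 h1.2.2⟩
  · have h := length_mul_swap (u := u * swap i a) hia (by simpa using hu)
    rw [mul_assoc, swap_mul_self, mul_one] at h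
    constructor
    · intro h'; omega
    · intro h'; exact absurd h'.1 hu.not_gt

/-- The Bruhat condition is implied by the length condition, which alone makes the exchange a cover.
-/
theorem mem_phi {w : Perm (Fin n)} {a b i : Fin n} :
    i ∈ phi w a b ↔ i < a ∧ IsCover (cornerPerm w a b) i a := by
  classical
  rw [phi, Finset.mem_filter]
  simp only [Finset.mem_univ, true_and]
  constructor
  · rintro ⟨h1, -, h2⟩
    exact ⟨h1, (length_mul_swap_eq_iff h1).1 h2⟩
  · rintro ⟨h1, h2⟩
    have h3 := (length_mul_swap_eq_iff h1).2 h2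
    exact ⟨h1, .single ⟨i, a, rfl, h3.symm⟩, h3⟩

end Length

/-! ### The sum over sets of covering positions, truncated at `j` for induction. -/

section TransitionSum

variable {R : Type*} [CommRing R] {n : ℕ} (β : R)
  (G : Perm (Fin n) → MvPolynomial (Fin n ⊕ Fin n) R)

open Classical in
/-- The positions `l` with `j ≤ l < a` whose transposition with `a` gives a cover of `u`. -/
noncomputable def covers (u : Perm (Fin n)) (a : Fin n) (j : ℕ) : Finset (Fin n) :=
  Finset.univ.filter fun l => j ≤ l ∧ l < a ∧ IsCover u l a

theorem mem_covers {u : Perm (Fin n)} {a l : Fin n} {j : ℕ} :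
    l ∈ covers u a j ↔ j ≤ l ∧ l < a ∧ IsCover u l a := by
  simp [covers]

/-- The sum of `β ^ #U` times the polynomial of `u (a i_k … i_1)` over the sets
`U = {i_1 < ⋯ < i_k}` of covering positions `≥ j`. -/
noncomputable def transitionSum (u : Perm (Fin n)) (a : Fin n) (j : ℕ) :
    MvPolynomial (Fin n ⊕ Fin n) R :=
  ∑ U ∈ (covers u a j).powerset, C β ^ U.card * G (u * (a :: U.sort (· ≥ ·)).formPerm)

theorem transitionSum_of_covers_eq_empty {u : Perm (Fin n)} {a : Fin n} {j : ℕ}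
    (h : covers u a j = ∅) : transitionSum β G u a j = G u := by
  simp [transitionSum, h]

theorem transitionSum_of_le {u : Perm (Fin n)} {a : Fin n} {j : ℕ} (h : (a : ℕ) ≤ j) :
    transitionSum β G u a j = G u := by
  apply transitionSum_of_covers_eq_empty
  ext l
  simp only [mem_covers, Finset.notMem_empty, iff_false, not_and, Fin.lt_def]
  omega

theorem transitionSum_of_not_isCover {u : Perm (Fin n)} {a j : Fin n} (h : ¬ IsCover u j a) :
    transitionSum β G u a j = transitionSum β G u a (j + 1) := by
  have : covers u a j = covers u a (j + 1) := by
    ext l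
    simp only [mem_covers]
    refine ⟨fun ⟨h1, h2, h3⟩ => ⟨?_, h2, h3⟩, fun ⟨h1, h2, h3⟩ => ⟨by omega, h2, h3⟩⟩
    rcases h1.eq_or_lt with h1 | h1
    · rw [Fin.ext h1] at h; exact absurd h3 h
    · exact h1
  rw [transitionSum, transitionSum, this]

theorem sort_insert_of_lt {U : Finset (Fin n)} {j : Fin n} (h : ∀ l ∈ U, j < l) :
    (insert j U).sort (· ≥ ·) = U.sort (· ≥ ·) ++ [j] := by
  have hj : j ∉ U := fun hj => (h j hj).false
  apply List.Perm.eq_of_pairwise' (r := (· ≥ ·)) (Finset.pairwise_sort _ _)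
  · rw [List.pairwise_append]
    refine ⟨Finset.pairwise_sort _ _, by simp, ?_⟩
    intro l hl m hm
    simp only [Finset.mem_sort, List.mem_singleton] at hl hm
    subst hm
    exact (h l hl).le
  · rw [← Multiset.coe_eq_coe, Finset.sort_eq, ← Multiset.coe_add, Finset.sort_eq,
      Finset.insert_val_of_notMem hj, Multiset.coe_singleton, ← Multiset.singleton_add, add_comm]

/-- Rotate the cycle to begin at its last letter `j`, then split off the first transposition. -/
theorem formPerm_cons_append_singleton {α : Type*} [DecidableEq α] {a j : α} {l : List α}
    (h : (j :: a :: l).Nodup) :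
    (a :: (l ++ [j])).formPerm = swap j a * (a :: l).formPerm := by
  rw [← List.formPerm_cons_cons, ← List.formPerm_rotate _ h 1]
  simp

/-- Split the sets `U` by whether they contain `j`. If they do, `j` is the smallest element, and the
cycle factors as `t_{j,a}` times the cycle of `U \ {j}`. -/
theorem transitionSum_of_isCover {u : Perm (Fin n)} {a j : Fin n} (hja : j < a)
    (h : IsCover u j a) :
    transitionSum β G u a j = transitionSum β G u a (j + 1) +
      C β * transitionSum β G (u * swap j a) a (j + 1) := by
  have h1 : covers u a j = insert j (covers u a (j + 1)) := by
    ext l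
    simp only [mem_covers, Finset.mem_insert]
    constructor
    · rintro ⟨h1, h2, h3⟩
      rcases h1.eq_or_lt with h1 | h1
      · exact Or.inl (Fin.ext h1.symm)
      · exact Or.inr ⟨h1, h2, h3⟩
    · rintro (rfl | ⟨h1, h2, h3⟩)
      · exact ⟨le_rfl, hja, h⟩
      · exact ⟨by omega, h2, h3⟩
  -- As `j` covers, no entry strictly between positions `j` and `a` has a value between `u j` and `u
  -- a`. For those entries, lying below `u a` or below `u j` is the same, so the later covering
  -- positions do not change.
  have h2 : covers (u * swap j a) a (j + 1) = covers u a (j + 1) := by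
    ext l
    simp only [mem_covers]
    refine and_congr_right fun hl => and_congr_right fun hla => ?_
    have hjl : j < l := hl
    have e : ∀ m, j < m → m < a → (u * swap j a) m = u m := fun m h1 h2 => by
      simp [swap_apply_of_ne_of_ne h1.ne' h2.ne]
    have ea : (u * swap j a) a = u j := by simp
    simp only [IsCover, ea, e l hjl hla]
    constructor
    · rintro ⟨h3, h4⟩
      refine ⟨h3.trans h.1, fun m hm1 hm2 hm3 hm4 => ?_⟩
      have h5 := h4 m hm1 hm2
      rw [e m (hjl.trans hm1) hm2] at h5
      have h6 := h5 hm3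
      exact h.2 m (hjl.trans hm1) hm2 (lt_of_le_of_ne (not_lt.1 h6)
        fun h7 => (hjl.trans hm1).ne (u.injective h7)) hm4
    · rintro ⟨h3, h4⟩
      refine ⟨lt_of_le_of_ne (not_lt.1 fun h5 => h.2 l hjl hla h5 h3)
        fun h7 => hjl.ne' (u.injective h7), fun m hm1 hm2 => ?_⟩
      rw [e m (hjl.trans hm1) hm2]
      exact fun hm3 hm4 => h4 m hm1 hm2 hm3 (hm4.trans h.1)
  have hj : j ∉ covers u a (j + 1) := by simp [mem_covers]
  rw [transitionSum, transitionSum, transitionSum, h1, h2, Finset.sum_powerset_insert hj,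
    Finset.mul_sum]
  congr 1
  refine Finset.sum_congr rfl fun U hU => ?_
  rw [Finset.mem_powerset] at hU
  have hlt : ∀ l ∈ U, j < l := fun l hl => (mem_covers.1 (hU hl)).1
  have hla : ∀ l ∈ U, l < a := fun l hl => (mem_covers.1 (hU hl)).2.1
  have hjU : j ∉ U := fun h => hj (hU h)
  rw [Finset.card_insert_of_notMem hjU, sort_insert_of_lt hlt, formPerm_cons_append_singleton,
    pow_succ', mul_assoc, mul_assoc]
  simp only [List.nodup_cons, List.mem_cons, Finset.mem_sort, Finset.sort_nodup, and_true, hjU,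
    or_false, hja.ne, not_false_eq_true, true_and]
  exact fun h => (hla a h).false

end TransitionSum

/-! ### Action of the operators on transition sums. -/

section Recursion

variable {R : Type*} [CommRing R] [IsDomain R] {n : ℕ} {β : R}
  {G : Perm (Fin n) → MvPolynomial (Fin n ⊕ Fin n) R}

/-- The family `G` satisfies the descending recursion of the Grothendieck polynomials. -/
def IsDescending (β : R) (G : Perm (Fin n) → MvPolynomial (Fin n ⊕ Fin n) R) : Prop :=
  ∀ (u : Perm (Fin n)) (i j : Fin n), (i : ℕ) + 1 = j → u j < u i →
    G (u * swap i j) = demazure β i j (G u)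

theorem isDescending_descend (top : MvPolynomial (Fin n ⊕ Fin n) R) :
    IsDescending β (descend β top) := by
  intro u i j hij hu
  rw [descend_eq_demazure β top (u * swap i j) (i, j) ⟨hij, by simpa using hu⟩]
  simp [mul_assoc]

/-- At an ascent `G u` is itself in the image of `π`, on which `π` acts as `-β`. -/
theorem IsDescending.demazure_of_lt (hG : IsDescending β G) {u : Perm (Fin n)} {i j : Fin n}
    (hij : (i : ℕ) + 1 = j) (hu : u i < u j) : demazure β i j (G u) = -(C β * G u) := by
  have hne : i ≠ j := by rintro rfl; omega
  have h := hG (u * swap i j) i j hij (by simpa using hu)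
  rw [mul_assoc, swap_mul_self, mul_one] at h
  rw [h, demazure_demazure β hne]

/-- The adjacent positions `i`, `i'` are both strictly between `j` and `a` or both outside, so the
exchange only permutes the entries tested. -/
theorem isCover_mul_swap_iff {u : Perm (Fin n)} {i i' j a : Fin n} (hi : (i : ℕ) + 1 = i')
    (hji : j ≠ i) (hji' : j ≠ i') (hai : a ≠ i) (hai' : a ≠ i') :
    IsCover (u * swap i i') j a ↔ IsCover u j a := by
  have aux : ∀ u : Perm (Fin n), IsCover u j a → IsCover (u * swap i i') j a := by
    rintro u ⟨h1, h2⟩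
    simp only [IsCover, Perm.mul_apply, swap_apply_of_ne_of_ne hji hji',
      swap_apply_of_ne_of_ne hai hai']
    refine ⟨h1, fun m hm1 hm2 => h2 _ ?_ ?_⟩
    all_goals
      rw [swap_apply_def]
      simp only [Fin.lt_def, ne_eq, Fin.ext_iff] at *
      split_ifs <;> omega
  refine ⟨fun h => ?_, aux u⟩
  have := aux _ h
  rwa [mul_assoc, swap_mul_self, mul_one] at this

theorem demazure_transitionSum_of_add_one {i i' a j : Fin n}
    (hi : (i : ℕ) + 1 = i') (hai : a ≠ i) (hai' : a ≠ i') (hja : j < a) (hji : j ≠ i) (hji' : j ≠ i')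
    (ih : ∀ u : Perm (Fin n), u i' < u i → demazure β i i' (transitionSum β G u a (j + 1)) =
      transitionSum β G (u * swap i i') a (j + 1))
    (u : Perm (Fin n)) (hu : u i' < u i) :
    demazure β i i' (transitionSum β G u a j) = transitionSum β G (u * swap i i') a j := by
  have hne : i ≠ i' := by rintro rfl; omega
  by_cases hc : IsCover u j a
  · rw [transitionSum_of_isCover β G hja hc,
      transitionSum_of_isCover β G hja ((isCover_mul_swap_iff hi hji hji' hai hai').2 hc),
      demazure_add β hne, demazure_mul_of_actX_eq β hne (actX_C _ _), ih u hu, ih, mul_assoc,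
      mul_assoc, swap_mul_swap_comm hji hji' hai hai']
    simpa [swap_apply_of_ne_of_ne hji.symm hai.symm, swap_apply_of_ne_of_ne hji'.symm hai'.symm]
      using hu
  · rw [transitionSum_of_not_isCover β G hc, transitionSum_of_not_isCover β G
      (fun h => hc ((isCover_mul_swap_iff hi hji hji' hai hai').1 h)), ih u hu]

theorem isCover_iff_of_eq {u u' : Perm (Fin n)} {i' a : Fin n}
    (h : ∀ m, i' < m → m < a → u' m = u m) :
    IsCover u' i' a ↔ u' i' < u' a ∧ ∀ m, i' < m → m < a → u' i' < u m → ¬ u m < u' a := by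
  refine and_congr_right fun _ => forall_congr' fun m => forall_congr' fun h1 =>
    forall_congr' fun h2 => ?_
  rw [h m h1 h2]

/-- With `isCover_iff_of_eq`, this reduces the covering conditions for all products of `u` with
exchanges among `i`, `i'`, `a` to comparisons with the same entries of `u` between `i'` and `a`. -/
theorem isCover_pred_iff_of_eq {u u' : Perm (Fin n)} {i i' a : Fin n} (hi : (i : ℕ) + 1 = i')
    (hia : i' < a) (h : ∀ m, i' < m → m < a → u' m = u m) :
    IsCover u' i a ↔ u' i < u' a ∧ ¬ (u' i < u' i' ∧ u' i' < u' a) ∧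
      ∀ m, i' < m → m < a → u' i < u m → ¬ u m < u' a := by
  refine and_congr_right fun _ => ?_
  have hii' : i < i' := by rw [Fin.lt_def]; omega
  constructor
  · intro h1
    refine ⟨fun h2 => h1 i' hii' hia h2.1 h2.2, fun m hm1 hm2 => ?_⟩
    rw [← h m hm1 hm2]
    exact h1 m (hii'.trans hm1) hm2
  · rintro ⟨h1, h2⟩ m hm1 hm2
    rcases eq_or_ne m i' with rfl | hm
    · exact fun h3 h4 => h1 ⟨h3, h4⟩
    · have hm' : i' < m := by
        rw [Fin.lt_def] at hm1 ⊢
        rw [ne_eq, Fin.ext_iff] at hm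
        omega
      rw [h m hm' hm2]
      exact h2 m hm' hm2

/-- The positions `i`, `i'` must be peeled off together. If just one of them covers `u`, the other
one covers `u s_i`, and the terms correspond. If neither does, the same holds for `u s_i`. If both
do, only `i'` covers `u s_i`, and the surplus terms cancel: `β π T(u t_{i',a}) = -β² T(u t_{i',a})`
against `β² π T(u t_{i,a} t_{i',a}) = β² T(u t_{i',a})`. -/
theorem demazure_transitionSum_pair {i i' a : Fin n}
    (hi : (i : ℕ) + 1 = i') (hia : i' < a)
    (ih : ∀ u : Perm (Fin n), u i' < u i → demazure β i i' (transitionSum β G u a (i' + 1)) =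
      transitionSum β G (u * swap i i') a (i' + 1))
    (u : Perm (Fin n)) (hu : u i' < u i) :
    demazure β i i' (transitionSum β G u a i) = transitionSum β G (u * swap i i') a i := by
  have hne : i ≠ i' := by rintro rfl; omega
  have hii' : i < i' := by rw [Fin.lt_def]; omega
  have hai' : a ≠ i' := hia.ne'
  have hai : a ≠ i := (hii'.trans hia).ne'
  have hi_lt : i < a := hii'.trans hia
  have hua : u a ≠ u i := fun h => hai (u.injective h)
  have hua' : u a ≠ u i' := fun h => hai' (u.injective h)
  have fixm : ∀ m, i' < m → m < a → m ≠ i ∧ m ≠ i' ∧ m ≠ a := fun m h1 h2 =>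
    ⟨(hii'.trans h1).ne', h1.ne', h2.ne⟩
  -- the covering conditions in terms of `u`
  have c1 := isCover_pred_iff_of_eq (u := u) hi hia (fun m _ _ => rfl)
  have c2 := isCover_iff_of_eq (u := u) (u' := u) (i' := i') (a := a) (fun m _ _ => rfl)
  have c3 := isCover_pred_iff_of_eq (u := u) (u' := u * swap i i') hi hia (fun m h1 h2 => by
    simp [swap_apply_of_ne_of_ne (fixm m h1 h2).1 (fixm m h1 h2).2.1])
  have c4 := isCover_iff_of_eq (u := u) (u' := u * swap i i') (i' := i') (a := a)
    (fun m h1 h2 => by simp [swap_apply_of_ne_of_ne (fixm m h1 h2).1 (fixm m h1 h2).2.1])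
  have c5 := isCover_iff_of_eq (u := u) (u' := u * swap i a) (i' := i') (a := a)
    (fun m h1 h2 => by simp [swap_apply_of_ne_of_ne (fixm m h1 h2).1 (fixm m h1 h2).2.2])
  have c6 := isCover_iff_of_eq (u := u) (u' := u * swap i i' * swap i a) (i' := i') (a := a)
    (fun m h1 h2 => by simp [swap_apply_of_ne_of_ne (fixm m h1 h2).1 (fixm m h1 h2).2.2,
      swap_apply_of_ne_of_ne (fixm m h1 h2).1 (fixm m h1 h2).2.1])
  simp only [Perm.mul_apply, swap_apply_left, swap_apply_right, swap_apply_of_ne_of_ne hai hai',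
    swap_apply_of_ne_of_ne hne.symm hai'.symm, hu.not_gt, false_and, not_false_eq_true,
    true_and, hu] at c1 c3 c4 c5 c6
  -- the permutations that occur
  have p1 : swap i i' * swap i' a = swap i a * swap i i' :=
    swap_mul_swap_eq hai.symm hai'.symm
  have p2 : swap i i' * swap i a = swap i' a * swap i i' := by
    rw [swap_comm i i']; exact swap_mul_swap_eq hai'.symm hai.symm
  have p3 : swap i a * swap i' a * swap i i' = swap i' a := by
    rw [mul_assoc, ← p2, ← mul_assoc, ← p1, mul_assoc, swap_comm i a,
      swap_mul_swap_eq hne.symm hai, ← mul_assoc, swap_comm i' i, swap_mul_self, one_mul]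
  -- The hypothesis `ih` applies to `u t_{i,a}` only if that has a descent at `i`, that is, if `u i'
  -- < u a`.
  have d1 : demazure β i i' (transitionSum β G (u * swap i a) a (i' + 1)) =
      transitionSum β G (u * swap i i' * swap i' a) a (i' + 1) ∨ u a < u i' := by
    refine (lt_or_gt_of_ne hua').symm.imp (fun h => ?_) id
    rw [ih, mul_assoc, ← p1, ← mul_assoc]
    simpa [swap_apply_of_ne_of_ne hne.symm hai'.symm] using h
  have e1 : (i : ℕ) + 1 = (i' : ℕ) := hi
  by_cases hQ : IsCover u i a <;> by_cases hP : IsCover u i' a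
  · have hQ' := c1.1 hQ
    have hP' := c2.1 hP
    have n3 : ¬ IsCover (u * swap i i') i a := fun h => (c3.1 h).2.1 hQ'.1
    have n4 : IsCover (u * swap i i') i' a := c4.2 hQ'
    have n5 : IsCover (u * swap i a) i' a :=
      c5.2 fun m h1 h2 h3 h4 => hP'.2 m h1 h2 h3 (h4.trans hQ'.1)
    have d1' := d1.resolve_right hP'.1.not_gt
    have d2 : demazure β i i' (transitionSum β G (u * swap i a * swap i' a) a (i' + 1)) =
        transitionSum β G (u * swap i' a) a (i' + 1) := by
      rw [ih, mul_assoc, mul_assoc, ← mul_assoc (swap i a), p3]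
      simpa [swap_apply_of_ne_of_ne hai.symm hne, swap_apply_of_ne_of_ne hne hai.symm]
        using hQ'.1
    have d3 : demazure β i i' (transitionSum β G (u * swap i' a) a (i' + 1)) =
        -(C β * transitionSum β G (u * swap i' a) a (i' + 1)) := by
      rw [← d2, demazure_demazure β hne]
    rw [transitionSum_of_isCover β G hi_lt hQ, transitionSum_of_not_isCover β G n3, e1,
      transitionSum_of_isCover β G hia hP, transitionSum_of_isCover β G hia n5,
      transitionSum_of_isCover β G hia n4]
    simp only [demazure_add β hne, demazure_mul_of_actX_eq β hne (actX_C _ _), ih u hu, d1', d2,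
      d3]
    ring
  · have hQ' := c1.1 hQ
    have n3 : ¬ IsCover (u * swap i i') i a := fun h => (c3.1 h).2.1 hQ'.1
    have n4 : IsCover (u * swap i i') i' a := c4.2 hQ'
    have n5 : ¬ IsCover (u * swap i a) i' a := by
      intro h
      refine hP (c2.2 ⟨hu.trans hQ'.1, fun m h1 h2 h3 h4 => ?_⟩)
      rcases lt_or_gt_of_ne (fun h => (fixm m h1 h2).1 (u.injective h) : u m ≠ u i) with h5 | h5
      · exact c5.1 h m h1 h2 h3 h5
      · exact hQ'.2 m h1 h2 h5 h4
    have d1' := d1.resolve_right (hu.trans hQ'.1).not_gt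
    rw [transitionSum_of_isCover β G hi_lt hQ, transitionSum_of_not_isCover β G n3, e1,
      transitionSum_of_not_isCover β G hP, transitionSum_of_not_isCover β G n5,
      transitionSum_of_isCover β G hia n4]
    simp only [demazure_add β hne, demazure_mul_of_actX_eq β hne (actX_C _ _), ih u hu, d1']
  · have hP' := c2.1 hP
    have hlt : u a < u i := by
      refine lt_of_le_of_ne (not_lt.1 fun h => hQ (c1.2 ⟨h, fun m h1 h2 h3 => ?_⟩)) hua
      exact hP'.2 m h1 h2 (hu.trans h3)
    have n3 : IsCover (u * swap i i') i a := c3.2 ⟨hP'.1, hlt.not_gt, hP'.2⟩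
    have n4 : ¬ IsCover (u * swap i i') i' a := fun h => hlt.not_gt (c4.1 h).1
    have n6 : ¬ IsCover (u * swap i i' * swap i a) i' a := c6.1
    have d2 : demazure β i i' (transitionSum β G (u * swap i' a) a (i' + 1)) =
        transitionSum β G (u * swap i i' * swap i a) a (i' + 1) := by
      rw [ih, mul_assoc, ← p2, ← mul_assoc]
      simpa [swap_apply_of_ne_of_ne hne hai.symm] using hlt
    rw [transitionSum_of_not_isCover β G hQ, transitionSum_of_isCover β G hi_lt n3, e1,
      transitionSum_of_isCover β G hia hP, transitionSum_of_not_isCover β G n4,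
      transitionSum_of_not_isCover β G n6]
    simp only [demazure_add β hne, demazure_mul_of_actX_eq β hne (actX_C _ _), ih u hu, d2]
  · have n4 : ¬ IsCover (u * swap i i') i' a := fun h => hQ (c1.2 (c4.1 h))
    have n3 : ¬ IsCover (u * swap i i') i a := fun h => hP (c2.2 ⟨(c3.1 h).1, (c3.1 h).2.2⟩)
    rw [transitionSum_of_not_isCover β G hQ, transitionSum_of_not_isCover β G n3, e1,
      transitionSum_of_not_isCover β G hP, transitionSum_of_not_isCover β G n4, ih u hu]

/-- The operators to the left of position `a` act on the transition sum as on the family. -/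
theorem demazure_transitionSum (hG : IsDescending β G) {i i' a : Fin n}
    (hi : (i : ℕ) + 1 = i') (hia : i' < a) (u : Perm (Fin n)) (hu : u i' < u i) :
    demazure β i i' (transitionSum β G u a 0) = transitionSum β G (u * swap i i') a 0 := by
  have hi'a : (i' : ℕ) < a := hia
  have hai : a ≠ i := by rintro rfl; omega
  -- The truncation never stops at `i'`: from `j = i` the induction passes directly to `i' + 1`.
  have key : ∀ k j : ℕ, j + k = a → j ≠ i' → ∀ u : Perm (Fin n), u i' < u i →
      demazure β i i' (transitionSum β G u a j) = transitionSum β G (u * swap i i') a j := by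
    intro k
    induction k using Nat.strong_induction_on with
    | _ k ih =>
    intro j hj hji' u hu
    rcases Nat.eq_zero_or_pos k with rfl | hk
    · rw [transitionSum_of_le β G (by omega), transitionSum_of_le β G (by omega),
        hG u i i' hi hu]
    have hjn : j < n := by omega
    by_cases hji : j = i
    · subst hji
      exact demazure_transitionSum_pair hi hia
        (ih (k - 2) (by omega) (i' + 1) (by omega) (by omega)) u hu
    · have hja : (⟨j, hjn⟩ : Fin n) < a := by rw [Fin.lt_def]; simp; omega
      exact demazure_transitionSum_of_add_one hi hai hia.ne' hja (fun h => hji (by simp [← h]))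
        (fun h => hji' (by simp [← h]))
        (ih (k - 1) (by omega) (j + 1) (by omega) (by omega)) u hu
  exact key a 0 (by omega) (by omega) u hu

/-- The operators to the right of position `a` act on the transition sum as on the family. -/
theorem demazure_transitionSum_of_gt (hG : IsDescending β G) {i i' a : Fin n}
    (hi : (i : ℕ) + 1 = i') (hai : a < i) (u : Perm (Fin n)) (hu : u i' < u i) :
    demazure β i i' (transitionSum β G u a 0) = transitionSum β G (u * swap i i') a 0 := by
  have hai' : a < i' := by rw [Fin.lt_def] at *; omega
  have key : ∀ k j : ℕ, j + k = a → ∀ u : Perm (Fin n), u i' < u i →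
      demazure β i i' (transitionSum β G u a j) = transitionSum β G (u * swap i i') a j := by
    intro k
    induction k with
    | zero =>
      intro j hj u hu
      rw [transitionSum_of_le β G (by omega), transitionSum_of_le β G (by omega), hG u i i' hi hu]
    | succ k ih =>
      intro j hj u hu
      have hjn : j < n := by omega
      have hja : (⟨j, hjn⟩ : Fin n) < a := by rw [Fin.lt_def]; simp; omega
      exact demazure_transitionSum_of_add_one hi hai.ne hai'.ne hja (hja.trans hai).ne
        (hja.trans hai').ne (ih (j + 1) (by omega)) u hu
  exact key a 0 (by omega) u hu

/-- Peeling off a covering position only lowers the entry at `e` and leaves the one at `a`. Hence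
all permutations in the sum keep the ascent at `(e, a)`, and `π + β` kills each term. -/
theorem demazure_add_transitionSum_eq_zero (hG : IsDescending β G) {e a : Fin n}
    (he : (e : ℕ) + 1 = a) (k j : ℕ) (hj : j + k = e) (u : Perm (Fin n)) (hu : u e < u a) :
    demazure β e a (transitionSum β G u e j) + C β * transitionSum β G u e j = 0 := by
  have hne : e ≠ a := by rintro rfl; omega
  induction k generalizing j u with
  | zero =>
    rw [transitionSum_of_le β G (by omega), hG.demazure_of_lt he hu]
    ring
  | succ k ih =>
    have hjn : j < n := by omega
    obtain ⟨l, rfl⟩ : ∃ l : Fin n, j = l := ⟨⟨j, hjn⟩, rfl⟩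
    have hle : l < e := by rw [Fin.lt_def]; omega
    have hla : a ≠ l := by rintro rfl; omega
    by_cases hc : IsCover u l e
    · rw [transitionSum_of_isCover β G hle hc, demazure_add β hne,
        demazure_mul_of_actX_eq β hne (actX_C _ _)]
      linear_combination ih (l + 1) (by omega) u hu + C β * ih (l + 1) (by omega) (u * swap l e)
        (by simpa [swap_apply_of_ne_of_ne hla hne.symm] using hc.1.trans hu)
    · rw [transitionSum_of_not_isCover β G hc]
      exact ih (l + 1) (by omega) u hu

/-- The comparison of the transition sums for the adjacent rows `e` and `a = e + 1`. -/
theorem demazure_add_transitionSum (hG : IsDescending β G) {e a : Fin n}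
    (he : (e : ℕ) + 1 = a) (k j : ℕ) (hj : j + k = e) (u : Perm (Fin n)) (hu : u e < u a) :
    demazure β e a (transitionSum β G (u * swap e a) e j) +
      C β * transitionSum β G (u * swap e a) e j = transitionSum β G u a j := by
  have hne : e ≠ a := by rintro rfl; omega
  have hea : e < a := by rw [Fin.lt_def]; omega
  induction k generalizing j u with
  | zero =>
    -- Base case: the left side is `G u + β G (u t_{e,a})`, and `e`, adjacent to `a`, is the one
    -- covering position `≥ e` on the right.
    obtain rfl : j = e := by omega
    have hc : IsCover u e a := ⟨hu, fun m h1 h2 => by rw [Fin.lt_def] at h1 h2; omega⟩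
    rw [transitionSum_of_le β G le_rfl, transitionSum_of_isCover β G hea hc,
      transitionSum_of_le β G (by omega), transitionSum_of_le β G (by omega),
      ← hG _ e a he (by simpa using hu), mul_assoc, swap_mul_self, mul_one]
  | succ k ih =>
    have hjn : j < n := by omega
    obtain ⟨l, rfl⟩ : ∃ l : Fin n, j = l := ⟨⟨j, hjn⟩, rfl⟩
    have hle : l < e := by rw [Fin.lt_def]; omega
    have hla : l < a := hle.trans hea
    have c1 : IsCover (u * swap e a) l e ↔
        u l < u a ∧ ∀ m, l < m → m < e → u l < u m → ¬ u m < u a := by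
      have e1 : (u * swap e a) l = u l := by
        simp [swap_apply_of_ne_of_ne hle.ne hla.ne]
      have e2 : (u * swap e a) e = u a := by simp
      rw [IsCover, e1, e2]
      refine and_congr_right fun _ => forall_congr' fun m => forall_congr' fun _ =>
        forall_congr' fun h2 => ?_
      have e3 : (u * swap e a) m = u m := by
        simp [swap_apply_of_ne_of_ne h2.ne (h2.trans hea).ne]
      rw [e3]
    have c2 : IsCover u l a ↔ IsCover (u * swap e a) l e ∧ ¬ u l < u e := by
      rw [c1]
      constructor
      · rintro ⟨h1, h2⟩
        exact ⟨⟨h1, fun m hm1 hm2 => h2 m hm1 (hm2.trans hea)⟩, fun h => h2 e hle hea h hu⟩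
      · rintro ⟨⟨h1, h2⟩, h3⟩
        refine ⟨h1, fun m hm1 hm2 => ?_⟩
        rcases eq_or_ne m e with rfl | hm
        · exact fun h => absurd h h3
        · refine h2 m hm1 ?_
          rw [Fin.lt_def] at hm2 ⊢
          rw [ne_eq, Fin.ext_iff] at hm
          omega
    by_cases hc : IsCover (u * swap e a) l e
    · rw [transitionSum_of_isCover β G hle hc, demazure_add β hne,
        demazure_mul_of_actX_eq β hne (actX_C _ _)]
      -- If `u l < u e`, position `l` does not cover at `a`, and its extra term is killed by `π +
      -- β`. Otherwise `l` covers on both sides and the extra terms match by induction.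
      by_cases hlt : u l < u e
      · rw [transitionSum_of_not_isCover β G (fun h => (c2.1 h).2 hlt)]
        have h0 := demazure_add_transitionSum_eq_zero hG he k (l + 1) (by omega)
          (u * swap e a * swap l e)
          (by simpa [swap_apply_of_ne_of_ne hle.ne hla.ne,
            swap_apply_of_ne_of_ne hla.ne' hne.symm] using hlt)
        linear_combination ih (l + 1) (by omega) u hu + C β * h0
      · rw [transitionSum_of_isCover β G hla (c2.2 ⟨hc, hlt⟩)]
        have hlt' : u e < u l :=
          lt_of_le_of_ne (not_lt.1 hlt) fun h => hle.ne' (u.injective h)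
        have h0 := ih (l + 1) (by omega) (u * swap l a)
          (by simpa [swap_apply_of_ne_of_ne hle.ne' hne] using hlt')
        have hp : u * swap l a * swap e a = u * swap e a * swap l e := by
          rw [mul_assoc, mul_assoc, swap_comm l a, swap_comm e a, swap_comm l e,
            swap_mul_swap_eq hla.ne' hle.ne']
        rw [hp] at h0
        linear_combination ih (l + 1) (by omega) u hu + C β * h0
    · rw [transitionSum_of_not_isCover β G hc,
        transitionSum_of_not_isCover β G (fun h => hc (c2.1 h).1)]
      exact ih (l + 1) (by omega) u hu

end Recursion

/-! ### Lehmer codes and the product formula for dominant permutations. -/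

section Dominant

variable {n : ℕ}

/-- The Lehmer code. -/
def lehmerCode (w : Perm (Fin n)) (k : Fin n) : ℕ :=
  (Finset.univ.filter fun l => k < l ∧ w l < w k).card

/-- Dominant permutations, by the condition that the Lehmer code is constant along ascents. -/
def IsDominant (w : Perm (Fin n)) : Prop :=
  ∀ i j : Fin n, (i : ℕ) + 1 = j → w i < w j → ∀ l, j < l → w l < w j → w l < w i

theorem lehmerCode_lt (w : Perm (Fin n)) (k : Fin n) : lehmerCode w k < n := by
  have h : (Finset.univ.filter fun l => k < l ∧ w l < w k) ⊆ Finset.univ.erase k := by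
    intro l hl
    simp only [Finset.mem_filter, Finset.mem_univ, true_and] at hl
    simp [hl.1.ne']
  have := Finset.card_le_card h
  rw [Finset.card_erase_of_mem (Finset.mem_univ _), Finset.card_univ, Fintype.card_fin] at this
  have := k.isLt
  rw [lehmerCode]
  omega

theorem lehmerCode_mul_of_lt_iff (w σ : Perm (Fin n)) {k : Fin n} (hk : σ k = k)
    (h : ∀ l, k < σ l ↔ k < l) : lehmerCode (w * σ) k = lehmerCode w k := by
  apply Finset.card_equiv σ
  intro l
  simp [hk, h]

theorem lehmerCode_mul_swap_of_ne (w : Perm (Fin n)) {i j k : Fin n} (hij : (i : ℕ) + 1 = j)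
    (hki : k ≠ i) (hkj : k ≠ j) : lehmerCode (w * swap i j) k = lehmerCode w k := by
  apply lehmerCode_mul_of_lt_iff _ _ (swap_apply_of_ne_of_ne hki hkj)
  intro l
  rw [swap_apply_def]
  simp only [Fin.lt_def, ne_eq, Fin.ext_iff] at *
  split_ifs <;> omega

theorem lehmerCode_mul_swap_left {w : Perm (Fin n)} {i j : Fin n} (hij : (i : ℕ) + 1 = j)
    (hw : w i < w j) : lehmerCode (w * swap i j) i = lehmerCode w j + 1 := by
  have hlt : i < j := by rw [Fin.lt_def]; omega
  have : (Finset.univ.filter fun l => i < l ∧ (w * swap i j) l < (w * swap i j) i) =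
      insert j (Finset.univ.filter fun l => j < l ∧ w l < w j) := by
    ext l
    simp only [Finset.mem_filter, Finset.mem_univ, true_and, Finset.mem_insert, Perm.mul_apply,
      swap_apply_left]
    rcases eq_or_ne l j with rfl | hlj
    · simp [hlt, hw]
    rcases eq_or_ne l i with rfl | hli
    · simp [hlj, hlt.not_gt]
    rw [swap_apply_of_ne_of_ne hli hlj]
    simp only [hlj, false_or]
    simp only [Fin.lt_def, ne_eq, Fin.ext_iff] at *
    exact and_congr_left fun _ => by omega
  rw [lehmerCode, this, Finset.card_insert_of_notMem (by simp), lehmerCode]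

theorem lehmerCode_mul_swap_right {w : Perm (Fin n)} {i j : Fin n} (hij : (i : ℕ) + 1 = j)
    (hw : w i < w j) : lehmerCode (w * swap i j) j = lehmerCode w i := by
  have hlt : i < j := by rw [Fin.lt_def]; omega
  rw [lehmerCode, lehmerCode]
  congr 1
  ext l
  simp only [Finset.mem_filter, Finset.mem_univ, true_and, Perm.mul_apply, swap_apply_right]
  rcases eq_or_ne l j with rfl | hlj
  · simp [hw.le]
  rcases eq_or_ne l i with rfl | hli
  · simp [hlt.le]
  rw [swap_apply_of_ne_of_ne hli hlj]
  simp only [Fin.lt_def, ne_eq, Fin.ext_iff] at *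
  exact and_congr_left fun _ => by omega

theorem IsDominant.lehmerCode_eq {w : Perm (Fin n)} (h : IsDominant w) {i j : Fin n}
    (hij : (i : ℕ) + 1 = j) (hw : w i < w j) : lehmerCode w i = lehmerCode w j := by
  rw [lehmerCode, lehmerCode]
  congr 1
  ext l
  simp only [Finset.mem_filter, Finset.mem_univ, true_and]
  constructor
  · rintro ⟨h1, h2⟩
    refine ⟨?_, h2.trans hw⟩
    have : l ≠ j := by rintro rfl; exact h2.not_gt hw
    simp only [Fin.lt_def, ne_eq, Fin.ext_iff] at *
    omega
  · rintro ⟨h1, h2⟩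
    refine ⟨?_, h i j hij hw l h1 h2⟩
    rw [Fin.lt_def] at *
    omega

/-- Exchanging the entries of the first ascent preserves dominance. -/
theorem IsDominant.mul_swap {w : Perm (Fin n)} (h : IsDominant w) {i j : Fin n}
    (hij : (i : ℕ) + 1 = j) (hw : w i < w j)
    (hfirst : ∀ k l : Fin n, (k : ℕ) + 1 = l → l ≤ i → w l < w k) :
    IsDominant (w * swap i j) := by
  have hlt : i < j := by rw [Fin.lt_def]; omega
  intro k l hkl hwkl m hlm hm
  have hkl' : k < l := by rw [Fin.lt_def]; omega
  simp only [Perm.mul_apply] at *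
  by_cases hli : l < i
  · have hki := hkl'.trans hli
    rw [swap_apply_of_ne_of_ne hki.ne (hki.trans hlt).ne,
      swap_apply_of_ne_of_ne hli.ne (hli.trans hlt).ne] at hwkl
    exact absurd hwkl (hfirst k l hkl hli.le).not_gt
  by_cases hli : l = i
  · subst hli
    have hwk := hfirst k l hkl le_rfl
    rw [swap_apply_of_ne_of_ne hkl'.ne (hkl'.trans hlt).ne] at hwkl ⊢
    rw [swap_apply_left] at hm hwkl
    rcases eq_or_ne m j with rfl | hmj
    · rwa [swap_apply_right]
    · rw [swap_apply_of_ne_of_ne hlm.ne' hmj] at hm ⊢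
      have hjm : j < m := by
        simp only [Fin.lt_def, ne_eq, Fin.ext_iff] at *
        omega
      exact (h l j hij hw m hjm hm).trans hwk
  by_cases hki : k = i
  · subst hki
    obtain rfl : l = j := by ext; omega
    rw [swap_apply_left, swap_apply_right] at hwkl
    exact absurd hwkl hw.not_gt
  by_cases hkj : k = j
  · subst hkj
    rw [swap_apply_right] at hwkl ⊢
    rw [swap_apply_of_ne_of_ne (hlt.trans hkl').ne' hkl'.ne'] at hwkl hm
    have him := (hlt.trans hkl').trans hlm
    have hkm := hkl'.trans hlm
    rw [swap_apply_of_ne_of_ne him.ne' hkm.ne'] at hm ⊢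
    rcases lt_or_gt_of_ne (fun e => hkl'.ne (w.injective e) : w k ≠ w l) with h1 | h1
    · exact h i k hij hw m hkm (h k l hkl h1 m hlm hm)
    · exact absurd (h i k hij hw l hkl' h1) hwkl.not_gt
  have hjk : j < k := by
    simp only [Fin.lt_def, Fin.ext_iff] at *
    omega
  have hik := hlt.trans hjk
  rw [swap_apply_of_ne_of_ne hik.ne' hjk.ne'] at hwkl ⊢
  rw [swap_apply_of_ne_of_ne (hik.trans hkl').ne' (hjk.trans hkl').ne'] at hwkl hm
  rw [swap_apply_of_ne_of_ne ((hik.trans hkl').trans hlm).ne' ((hjk.trans hkl').trans hlm).ne']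
    at hm ⊢
  exact h k l hkl hwkl m hlm hm

theorem lt_of_forall_not_isAscent {w : Perm (Fin n)} (h : ¬ ∃ p, IsAscent w p) {k l : Fin n}
    (hkl : k < l) : w l < w k := by
  have key : ∀ (m : ℕ) (k l : Fin n), (k : ℕ) + m + 1 = l → w l < w k := by
    intro m
    induction m with
    | zero =>
      intro k l hkl
      refine lt_of_le_of_ne (not_lt.1 fun h' => h ⟨(k, l), hkl, h'⟩) fun e => ?_
      have := w.injective e
      subst this
      omega
    | succ m ih =>
      intro k l hkl
      have hm : (k : ℕ) + m + 1 < n := by omega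
      refine lt_trans ?_ (ih k ⟨k + m + 1, hm⟩ rfl)
      refine lt_of_le_of_ne (not_lt.1 fun h' => h ⟨(_, l), by rw [← hkl]; simp; omega, h'⟩) fun e => ?_
      have := w.injective e
      subst this
      simp at hkl
  exact key (l - k - 1) k l (by rw [Fin.lt_def] at hkl; omega)

/-- All values below `w a` must occur to the right of `a`. -/
theorem lehmerCode_eq_apply {w : Perm (Fin n)} {a : Fin n} (h : ∀ k, k < a → w a < w k) :
    lehmerCode w a = w a := by
  rw [← Fin.card_Iio (w a), lehmerCode]
  apply Finset.card_equiv w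
  intro l
  simp only [Finset.mem_filter, Finset.mem_univ, true_and, Finset.mem_Iio]
  refine ⟨fun h' => h'.2, fun h' => ⟨?_, h'⟩⟩
  rcases lt_trichotomy l a with h1 | rfl | h1
  · exact absurd h' (h l h1).not_gt
  · exact absurd h' (lt_irrefl _)
  · exact h1

variable {R : Type*} [CommRing R] (β : R)

/-- The product `∏ (x_k ⊕ y_j)` over the diagram of rows given by the Lehmer code. -/
noncomputable def lehmerProd (w : Perm (Fin n)) : MvPolynomial (Fin n ⊕ Fin n) R :=
  ∏ k, ∏ j ∈ Finset.univ.filter (fun j : Fin n => (j : ℕ) < lehmerCode w k), oplus β k j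

/-- The codes at `i` and `j` agree by dominance; the exchange raises the one at `i` by one and
changes no other, which adds one factor. -/
theorem lehmerProd_mul_swap {w : Perm (Fin n)} (h : IsDominant w) {i j : Fin n}
    (hij : (i : ℕ) + 1 = j) (hw : w i < w j) :
    lehmerProd β (w * swap i j) =
      oplus β i ⟨lehmerCode w i, lehmerCode_lt w i⟩ * lehmerProd β w := by
  rw [lehmerProd, lehmerProd, ← Finset.mul_prod_erase _ _ (Finset.mem_univ i),
    ← Finset.mul_prod_erase (a := i) Finset.univ
      (fun k => ∏ j ∈ Finset.univ.filter (fun j : Fin n => (j : ℕ) < lehmerCode w k), oplus β k j) (Finset.mem_univ i),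
    ← mul_assoc]
  congr 1
  · rw [lehmerCode_mul_swap_left hij hw, ← h.lehmerCode_eq hij hw]
    have : (Finset.univ.filter fun l : Fin n => (l : ℕ) < lehmerCode w i + 1) =
        insert ⟨lehmerCode w i, lehmerCode_lt w i⟩
          (Finset.univ.filter fun l : Fin n => (l : ℕ) < lehmerCode w i) := by
      ext l
      simp only [Finset.mem_filter, Finset.mem_univ, true_and, Finset.mem_insert, Fin.ext_iff]
      omega
    rw [this, Finset.prod_insert (by simp)]
  · refine Finset.prod_congr rfl fun k hk => ?_
    rw [Finset.mem_erase] at hk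
    rcases eq_or_ne k j with rfl | hkj
    · rw [lehmerCode_mul_swap_right hij hw, h.lehmerCode_eq hij hw]
    · rw [lehmerCode_mul_swap_of_ne w hij hk.1 hkj]

theorem actX_lehmerProd {w : Perm (Fin n)} {i j : Fin n} (h : lehmerCode w i = lehmerCode w j) :
    actX (swap i j) (lehmerProd β w) = lehmerProd β w := by
  have h1 : actX (swap i j) (lehmerProd β w) =
      ∏ k, ∏ l ∈ Finset.univ.filter (fun l : Fin n => (l : ℕ) < lehmerCode w k), oplus β (swap i j k) l := by
    simp only [lehmerProd, actX, map_prod]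
    refine Finset.prod_congr rfl fun k _ => Finset.prod_congr rfl fun l _ => ?_
    change actX (swap i j) (oplus β k l) = _
    simp [oplus]
  rw [h1, lehmerProd, ← Equiv.prod_comp (swap i j)]
  refine Finset.prod_congr rfl fun k _ => ?_
  have : lehmerCode w (swap i j k) = lehmerCode w k := by
    rw [swap_apply_def]
    split_ifs with h2 h3
    · rw [h2, h]
    · rw [h3, h]
    · rfl
  rw [this]
  simp only [swap_apply_self]

theorem isDescending_grothendieck [IsDomain R] :
    IsDescending β (grothendieck β : Perm (Fin n) → MvPolynomial (Fin n ⊕ Fin n) R) :=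
  isDescending_descend _

theorem grothendieck_of_forall_not_isAscent {w : Perm (Fin n)} (h : ¬ ∃ p, IsAscent w p) :
    grothendieck β w = ∏ p ∈ Finset.univ.filter
      (fun p : Fin n × Fin n => (p.1 : ℕ) + p.2 + 2 ≤ n), oplus β p.1 p.2 := by
  rw [grothendieck, descend, dif_neg h]

/-- The Grothendieck polynomial of a dominant permutation is a product. -/
theorem grothendieck_of_isDominant [IsDomain R] {w : Perm (Fin n)} (hw : IsDominant w) :
    grothendieck β w = lehmerProd β w := by
  induction hN : ∑ k : Fin n, (k : ℕ) * (w k : ℕ) using Nat.strong_induction_on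
    generalizing w with
  | _ N ih =>
  subst hN
  by_cases h : ∃ p, IsAscent w p
  · obtain ⟨p, hp, hmin⟩ := exists_minimalFor_of_wellFoundedLT (IsAscent w)
      (fun p : Fin n × Fin n => p.1) h
    obtain ⟨i, j⟩ := p
    obtain ⟨hij, hlt⟩ := id hp
    simp only at hij hlt hmin
    have hne : i ≠ j := by rintro rfl; omega
    have hfirst : ∀ k l : Fin n, (k : ℕ) + 1 = l → l ≤ i → w l < w k := by
      intro k l hkl hli
      rw [Fin.le_def] at hli
      refine lt_of_le_of_ne (not_lt.1 fun h' => ?_) fun e => ?_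
      · have := @hmin (k, l) ⟨hkl, h'⟩ (by rw [Fin.le_def]; simp; omega)
        rw [Fin.le_def] at this
        simp at this
        omega
      · have := w.injective e
        subst this
        omega
    have h1 := isDescending_grothendieck β (w * swap i j) i j hij (by simpa using hlt)
    rw [mul_assoc, swap_mul_self, mul_one,
      ih _ (sum_mul_swap_lt w (i, j) hp) (hw.mul_swap hij hlt hfirst) rfl,
      lehmerProd_mul_swap β hw hij hlt, mul_comm,
      demazure_mul_of_actX_eq β hne (actX_lehmerProd β (hw.lehmerCode_eq hij hlt)),
      demazure_oplus β hne, mul_one] at h1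
    exact h1
  · rw [grothendieck_of_forall_not_isAscent β h, lehmerProd, Finset.prod_filter,
      Fintype.prod_prod_type]
    refine Finset.prod_congr rfl fun k _ => ?_
    rw [← Finset.prod_filter]
    have hcode : lehmerCode w k = n - 1 - k := by
      rw [← Fin.card_Ioi, lehmerCode]
      congr 1
      ext l
      simp only [Finset.mem_filter, Finset.mem_univ, true_and, Finset.mem_Ioi]
      exact ⟨fun h' => h'.1, fun h' => ⟨h', lt_of_forall_not_isAscent h h'⟩⟩
    rw [hcode]
    congr 1
    ext l
    simp only [Finset.mem_filter, Finset.mem_univ, true_and]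
    omega

end Dominant

/-! ### Transition configurations and the induction. -/

section Transition

variable {n : ℕ}

/-- The configuration of a transition, seen from `v = w t_{a,d}`: the entries of `v` weakly
southeast of `(a, v a)` are increasing, and the one after `(a, v a)` is in row `d`. -/
structure IsTransition (v : Perm (Fin n)) (a d : Fin n) : Prop where
  lt : a < d
  apply_lt : v a < v d
  between : ∀ k, a < k → k < d → v k < v a
  increasing : ∀ k l, a ≤ k → k < l → v a ≤ v l → v k < v l

/-- Any violation produces a cell of the Rothe diagram weakly southeast of `(a, b)` and different
from it: `(k, b)` for an entry between rows `a` and `d`, and `(k, w l)` for an inversion. -/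
theorem IsLowerOutsideCorner.isTransition {w : Perm (Fin n)} {a b : Fin n}
    (h : IsLowerOutsideCorner w a b) : IsTransition (cornerPerm w a b) a (w⁻¹ b) := by
  obtain ⟨⟨h1, h2⟩, hmax⟩ := h
  simp only at h1 h2
  have hmax' : ∀ k j, j < w k → k < w⁻¹ j → a ≤ k → b ≤ j → k ≤ a ∧ j ≤ b :=
    fun k j h3 h4 h5 h6 => @hmax (k, j) ⟨h3, h4⟩ ⟨h5, h6⟩
  have hwd : w (w⁻¹ b) = b := by simp
  generalize hd : w⁻¹ b = d at *
  have ha : cornerPerm w a b a = b := by simp [cornerPerm, hd, hwd]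
  have hd' : cornerPerm w a b d = w a := by simp [cornerPerm, hd]
  have hk : ∀ k, k ≠ a → k ≠ d → cornerPerm w a b k = w k := fun k h3 h4 => by
    simp [cornerPerm, hd, swap_apply_of_ne_of_ne h3 h4]
  have hbetween : ∀ k, a < k → k < d → w k < b := by
    intro k h3 h4
    by_contra h5
    have h6 : b < w k := lt_of_le_of_ne (not_lt.1 h5) fun e => by
      rw [← hwd] at e
      exact h4.ne' (w.injective e)
    exact absurd (hmax' k b h6 (by rwa [hd]) h3.le le_rfl).1 h3.not_ge
  refine ⟨h2, by rwa [ha, hd'], fun k h3 h4 => ?_, fun k l hak hkl hl => ?_⟩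
  · rw [ha, hk k h3.ne' h4.ne]
    exact hbetween k h3 h4
  · refine lt_of_le_of_ne (not_lt.1 fun hlt => ?_) fun e => hkl.ne (Equiv.injective _ e)
    rw [ha] at hl
    rcases hak.eq_or_lt with rfl | hak
    · rw [ha] at hlt
      exact hl.not_gt hlt
    have hal := hak.trans hkl
    rcases eq_or_ne l d with rfl | hld
    · rw [hd', hk k hak.ne' hkl.ne] at hlt
      exact ((hbetween k hak hkl).trans h1).not_gt hlt
    rw [hk l hal.ne' hld] at hl hlt
    -- In row `d` the entry of `v` is `w a`, so the offending cell lies in row `a`, at `(a, w l)`.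
    rcases eq_or_ne k d with rfl | hkd
    · rw [hd'] at hlt
      have h3 := (hmax' a (w l) hlt (by simpa using hal) le_rfl hl).2
      have h4 : w l = w k := by rw [hwd]; exact le_antisymm h3 hl
      exact hkl.ne' (w.injective h4)
    · rw [hk k hak.ne' hkd] at hlt
      exact (hmax' k (w l) hlt (by simpa using hkl) hak.le hl).1.not_gt hak

variable {R : Type*} [CommRing R] [IsDomain R] (β : R)

theorem IsTransition.mul_swap_of_lt {v : Perm (Fin n)} {a d i i' : Fin n}
    (h : IsTransition v a d) (hi : i < a) (hi' : i' < a) :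
    IsTransition (v * swap i i') a d := by
  have e : ∀ k, a ≤ k → (v * swap i i') k = v k := fun k hk => by
    simp [swap_apply_of_ne_of_ne (hi.trans_le hk).ne' (hi'.trans_le hk).ne']
  refine ⟨h.lt, ?_, fun k h1 h2 => ?_, fun k l h1 h2 => ?_⟩
  · rw [e a le_rfl, e d h.lt.le]; exact h.apply_lt
  · rw [e a le_rfl, e k h1.le]; exact h.between k h1 h2
  · rw [e a le_rfl, e k h1, e l (h1.trans h2.le)]; exact h.increasing k l h1 h2

/-- The value `v a` moves up to row `e`, and the smaller entry `v e` moves to row `a`, where it is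
harmless. -/
theorem IsTransition.mul_swap_pred {v : Perm (Fin n)} {a d e : Fin n}
    (h : IsTransition v a d) (he : (e : ℕ) + 1 = a) (hv : v e < v a) :
    IsTransition (v * swap e a) e d := by
  have hea : e < a := by rw [Fin.lt_def]; omega
  have h0 : ∀ k, a < k → (v * swap e a) k = v k := fun k hk => by
    simp [swap_apply_of_ne_of_ne (hea.trans hk).ne' hk.ne']
  have h1 : (v * swap e a) e = v a := by simp
  have h2 : (v * swap e a) a = v e := by simp
  have h3 : ∀ k, e < k → k ≠ a → a < k := fun k hk hka => by
    simp only [Fin.lt_def, ne_eq, Fin.ext_iff] at *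
    omega
  refine ⟨hea.trans h.lt, ?_, fun k hk1 hk2 => ?_, fun k l hk hkl hl => ?_⟩
  · rw [h1, h0 d h.lt]; exact h.apply_lt
  · rw [h1]
    rcases eq_or_ne k a with rfl | hka
    · rwa [h2]
    · rw [h0 k (h3 k hk1 hka)]; exact h.between k (h3 k hk1 hka) hk2
  · rw [h1] at hl
    have hla : a < l := h3 l (hk.trans_lt hkl) fun e' => by
      rw [e', h2] at hl
      exact hl.not_gt hv
    rw [h0 l hla] at hl ⊢
    rcases hk.eq_or_lt with rfl | hk
    · rw [h1]; exact h.increasing a l le_rfl hla hl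
    · rcases eq_or_ne k a with rfl | hka
      · rw [h2]; exact hv.trans_le hl
      · rw [h0 k (h3 k hk hka)]
        exact h.increasing k l (h3 k hk hka).le hkl hl

/-- The entry moved down is below `v a`, so the relative order of the entries that are at least `v
a` is unaffected. Row `d` may be `i'`, in which case it moves to `i`. -/
theorem IsTransition.mul_swap_of_gt {v : Perm (Fin n)} {a d i i' : Fin n}
    (h : IsTransition v a d) (hi : (i : ℕ) + 1 = i') (hai : a < i) (hv : v i < v a) :
    IsTransition (v * swap i i') a (swap i i' d) := by
  have hii' : i < i' := by rw [Fin.lt_def]; omega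
  have ha : (v * swap i i') a = v a := by
    simp [swap_apply_of_ne_of_ne hai.ne (hai.trans hii').ne]
  have hdi : d ≠ i := by rintro rfl; exact h.apply_lt.not_gt hv
  have hmono : ∀ k, a < k → a < swap i i' k := fun k hk => by
    rw [swap_apply_def]
    split_ifs
    exacts [hai.trans hii', hai, hk]
  have hmono' : ∀ k, a ≤ k → a ≤ swap i i' k := fun k hk => by
    rw [swap_apply_def]
    split_ifs
    exacts [(hai.trans hii').le, hai.le, hk]
  have hlt : ∀ k l, k < l → l ≠ i' → swap i i' k < swap i i' l ∨ v (swap i i' k) < v a := by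
    intro k l hkl hl
    rcases eq_or_ne k i' with rfl | hk
    · right; rwa [swap_apply_right]
    left
    rw [swap_apply_def, swap_apply_def]
    simp only [Fin.lt_def, ne_eq, Fin.ext_iff] at *
    split_ifs <;> omega
  refine ⟨hmono d h.lt, ?_, fun k h1 h2 => ?_, fun k l h1 h2 h3 => ?_⟩
  · rw [ha]; simpa using h.apply_lt
  · rw [ha, Perm.mul_apply]
    have hd' : swap i i' d ≠ i' := fun e => hdi ((swap i i').injective
      (e.trans (swap_apply_left i i').symm))
    rcases hlt k _ h2 hd' with h4 | h4
    · rw [swap_apply_self] at h4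
      exact h.between _ (hmono k h1) h4
    · exact h4
  · rw [ha] at h3
    have hl : l ≠ i' := by
      rintro rfl
      rw [Perm.mul_apply, swap_apply_right] at h3
      exact h3.not_gt hv
    rcases hlt k l h2 hl with h4 | h4
    · exact h.increasing _ _ (hmono' k h1) h4 h3
    · exact h4.trans_le h3

/-- The transition identity for a dominant `v` that exceeds `v a` in all rows above `a`. -/
theorem grothendieck_add_of_isDominant {v : Perm (Fin n)} {a d : Fin n} (hv : IsDominant v)
    (had : (a : ℕ) + 1 = d) (hlt : v a < v d)
    (hdec : ∀ k l : Fin n, (k : ℕ) + 1 = l → l ≤ a → v l < v k) :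
    grothendieck β v + C β * grothendieck β (v * swap a d) =
      (1 + C β * x a) * (1 + C β * y (v a)) * transitionSum β (grothendieck β) v a 0 := by
  have hbig : ∀ k, k < a → v a < v k := by
    intro k hk
    have key : ∀ (m : ℕ) (k : Fin n), (k : ℕ) + m + 1 = a → v a < v k := by
      intro m
      induction m with
      | zero => exact fun k hk => hdec k a hk le_rfl
      | succ m ih =>
        intro k hk
        have hk1 : (k : ℕ) + 1 < n := by omega
        exact (ih ⟨k + 1, hk1⟩ (by simp; omega)).trans
          (hdec k ⟨k + 1, hk1⟩ rfl (by rw [Fin.le_def]; simp; omega))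
    rw [Fin.lt_def] at hk
    exact key (a - k - 1) k (by omega)
  have hc : covers v a 0 = ∅ := by
    ext l
    simp only [mem_covers, Finset.notMem_empty, iff_false]
    rintro ⟨-, h1, h2⟩
    exact h2.1.not_gt (hbig l h1)
  rw [transitionSum_of_covers_eq_empty β _ hc,
    grothendieck_of_isDominant β (hv.mul_swap had hlt hdec), grothendieck_of_isDominant β hv,
    lehmerProd_mul_swap β hv had hlt]
  have : (⟨lehmerCode v a, lehmerCode_lt v a⟩ : Fin n) = v a :=
    Fin.ext (lehmerCode_eq_apply hbig)
  rw [this, oplus]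
  ring

/-- The transition identity, multiplied by `β`. -/
theorem grothendieck_add_of_isTransition {v : Perm (Fin n)} {a d : Fin n}
    (h : IsTransition v a d) :
    grothendieck β v + C β * grothendieck β (v * swap a d) =
      (1 + C β * x a) * (1 + C β * y (v a)) * transitionSum β (grothendieck β) v a 0 := by
  have hG := isDescending_grothendieck (n := n) β
  induction hN : ∑ k : Fin n, (k : ℕ) * (v k : ℕ) using Nat.strong_induction_on
    generalizing v a d with
  | _ N ih =>
  subst hN
  -- An ascent left of `a`: the factor in front is symmetric in `x_i`, `x_{i'}`, and `π_i` acts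
  -- termwise on the identity for `v s_i`.
  by_cases hA : ∃ i i' : Fin n, (i : ℕ) + 1 = i' ∧ i' < a ∧ v i < v i'
  · obtain ⟨i, i', hi, hi'a, hv⟩ := hA
    have hii' : i < i' := by rw [Fin.lt_def]; omega
    have hia := hii'.trans hi'a
    have hid := hia.trans h.lt
    have hi'd := hi'a.trans h.lt
    have h1 := ih _ (sum_mul_swap_lt v (i, i') ⟨hi, hv⟩) (h.mul_swap_of_lt hia hi'a) rfl
    have h2 := congrArg (demazure β i i') h1
    have hsym : actX (swap i i')
        ((1 + C β * x a) * (1 + C β * y ((v * swap i i') a)) : MvPolynomial (Fin n ⊕ Fin n) R) =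
        (1 + C β * x a) * (1 + C β * y ((v * swap i i') a)) := by
      simp [swap_apply_of_ne_of_ne hia.ne' hi'a.ne']
    rw [demazure_mul_of_actX_eq β hii'.ne hsym, demazure_add β hii'.ne,
      demazure_mul_of_actX_eq β hii'.ne (actX_C _ _),
      demazure_transitionSum hG hi hi'a _ (by simpa using hv),
      ← hG _ i i' hi (by simpa using hv), ← hG _ i i' hi (by
        simpa [swap_apply_of_ne_of_ne hia.ne hid.ne, swap_apply_of_ne_of_ne hi'a.ne hi'd.ne]
          using hv),
      mul_assoc (v * _), swap_mul_swap_comm hia.ne' hi'a.ne' hid.ne' hi'd.ne', ← mul_assoc,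
      mul_assoc v, swap_mul_self, mul_one] at h2
    simpa [swap_apply_of_ne_of_ne hia.ne' hi'a.ne'] using h2
  -- An ascent at `(e, a)`: the identity for `v t_{e,a}` concerns row `e`, and the Leibniz rule
  -- turns `1 + β x_e` into `1 + β x_a` and `π` into `π + β`.
  by_cases hB : ∃ e : Fin n, (e : ℕ) + 1 = a ∧ v e < v a
  · obtain ⟨e, he, hv⟩ := hB
    have hea : e < a := by rw [Fin.lt_def]; omega
    have hed := hea.trans h.lt
    have h1 := ih _ (sum_mul_swap_lt v (e, a) ⟨he, hv⟩) (h.mul_swap_pred he hv) rfl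
    have h2 := congrArg (demazure β e a) h1
    have hsym : actX (swap e a)
        (1 + C β * y ((v * swap e a) e) : MvPolynomial (Fin n ⊕ Fin n) R) =
        1 + C β * y ((v * swap e a) e) := by
      simp
    rw [mul_comm (1 + C β * x e), mul_assoc (1 + C β * y _), demazure_mul_of_actX_eq β hea.ne hsym,
      demazure_one_add_mul β hea.ne, demazure_add β hea.ne,
      demazure_mul_of_actX_eq β hea.ne (actX_C _ _),
      demazure_add_transitionSum hG he e 0 (by omega) v hv,
      ← hG _ e a he (by simpa using hv), ← hG _ e a he (by
        simpa [swap_apply_of_ne_of_ne hea.ne' h.lt.ne, swap_apply_of_ne_of_ne hed.ne' h.lt.ne']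
          using hv.trans h.apply_lt)] at h2
    have hp : v * swap e a * swap e d * swap e a = v * swap a d := by
      rw [mul_assoc v, swap_comm e a, swap_mul_swap_eq h.lt.ne hed.ne, ← mul_assoc, mul_assoc,
        swap_mul_self, mul_one]
    rw [hp, mul_assoc v, swap_mul_self, mul_one, Perm.mul_apply, swap_apply_left] at h2
    rw [h2]
    ring
  -- An ascent right of `a` starting below `v a`: the identity used has `s_i(d)` in place of `d`.
  by_cases hC : ∃ i i' : Fin n, (i : ℕ) + 1 = i' ∧ a < i ∧ v i < v a ∧ v i < v i'
  · obtain ⟨i, i', hi, hai, hva, hv⟩ := hC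
    have hii' : i < i' := by rw [Fin.lt_def]; omega
    have hai' := hai.trans hii'
    have h1 := ih _ (sum_mul_swap_lt v (i, i') ⟨hi, hv⟩) (h.mul_swap_of_gt hi hai hva) rfl
    have h2 := congrArg (demazure β i i') h1
    have hdi : i ≠ d := by rintro rfl; exact h.apply_lt.not_gt hva
    have hp : v * swap i i' * swap a (swap i i' d) = v * swap a d * swap i i' := by
      rw [mul_assoc, mul_swap_eq_swap_mul, swap_apply_self,
        swap_apply_of_ne_of_ne hai.ne hai'.ne, mul_assoc]
    have hlt : v i < (v * swap a d) i' := by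
      rcases eq_or_ne i' d with rfl | hd
      · simpa using hva
      · simpa [swap_apply_of_ne_of_ne hai'.ne' hd] using hv
    have hsym : actX (swap i i')
        ((1 + C β * x a) * (1 + C β * y ((v * swap i i') a)) : MvPolynomial (Fin n ⊕ Fin n) R) =
        (1 + C β * x a) * (1 + C β * y ((v * swap i i') a)) := by
      simp [swap_apply_of_ne_of_ne hai.ne hai'.ne]
    rw [demazure_mul_of_actX_eq β hii'.ne hsym, demazure_add β hii'.ne,
      demazure_mul_of_actX_eq β hii'.ne (actX_C _ _),
      demazure_transitionSum_of_gt hG hi hai _ (by simpa using hv), hp,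
      ← hG _ i i' hi (by simpa using hv), ← hG _ i i' hi (by
        simpa [swap_apply_of_ne_of_ne hai.ne' hdi] using hlt),
      mul_assoc (v * _), mul_assoc v, swap_mul_self, mul_one, mul_one] at h2
    simpa [swap_apply_of_ne_of_ne hai.ne hai'.ne] using h2
  · push Not at hA hB hC
    have hdec : ∀ k l : Fin n, (k : ℕ) + 1 = l → l ≤ a → v l < v k := by
      intro k l hkl hl
      have hne : v l ≠ v k := fun e => by
        have := v.injective e
        subst this
        omega
      rcases hl.eq_or_lt with rfl | hl
      · exact lt_of_le_of_ne (hB k hkl) hne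
      · exact lt_of_le_of_ne (hA k l hkl hl) hne
    have hdesc : ∀ i i' : Fin n, (i : ℕ) + 1 = i' → a < i → v i < v a → v i' < v i := by
      intro i i' hi h1 h2
      exact lt_of_le_of_ne (hC i i' hi h1 h2) fun e => by
        have := v.injective e
        subst this
        omega
    -- Were there rows between `a` and `d`, their entries would lie below `v a`, and the descents
    -- from `hdesc` would continue down to row `d`, contradicting `v a < v d`.
    have had : (a : ℕ) + 1 = d := by
      have hlt := h.lt
      rw [Fin.lt_def] at hlt
      by_contra hne
      have key : ∀ m : ℕ, ∀ k : Fin n, (k : ℕ) = a + 1 + m → k ≤ d → v k < v a := by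
        intro m
        induction m with
        | zero =>
          intro k hk hkd
          rw [Fin.le_def] at hkd
          exact h.between k (by rw [Fin.lt_def]; omega) (by rw [Fin.lt_def]; omega)
        | succ m ihm =>
          intro k hk hkd
          rw [Fin.le_def] at hkd
          have hn : (a : ℕ) + 1 + m < n := by omega
          have h3 := ihm ⟨a + 1 + m, hn⟩ rfl (by rw [Fin.le_def]; simp; omega)
          exact (hdesc ⟨a + 1 + m, hn⟩ k (by simp; omega)
            (by rw [Fin.lt_def]; simp; omega) h3).trans h3
      exact (key (d - a - 1) d (by omega) le_rfl).not_gt h.apply_lt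
    refine grothendieck_add_of_isDominant β ?_ had h.apply_lt hdec
    -- Dominance: an ascent must start at or after `a` with `v i ≥ v a`; a later entry below `v j`
    -- must lie below `v a`, because entries southeast of `(a, v a)` increase.
    intro i j hij hlt l hjl hl
    have hai : a ≤ i := by
      by_contra hai
      refine (hdec i j hij ?_).not_gt hlt
      rw [Fin.le_def] at *
      omega
    have hia : v a ≤ v i := by
      by_contra hia
      rcases hai.eq_or_lt with rfl | hai
      · exact hia le_rfl
      · exact (hdesc i j hij hai (not_le.1 hia)).not_gt hlt
    refine lt_of_lt_of_le (not_le.1 fun h3 => ?_) hia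
    have hij' : i < j := by rw [Fin.lt_def]; omega
    exact (h.increasing j l (hai.trans hij'.le) hjl h3).not_gt hl

end Transition

/-! ### Cancelling `β`, and the specialization to Schubert polynomials. -/

section Specialization

variable {n : ℕ}

theorem cornerPerm_mul_swap (w : Perm (Fin n)) (a b : Fin n) :
    cornerPerm w a b * swap a (w⁻¹ b) = w := by
  rw [cornerPerm, mul_assoc, swap_mul_self, mul_one]

theorem cornerPerm_apply (w : Perm (Fin n)) (a b : Fin n) : cornerPerm w a b a = b := by
  simp [cornerPerm]

/-- The transition formula for `β`-double Grothendieck polynomials. -/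
theorem grothendieck_transition {R : Type*} [CommRing R] [IsDomain R] {β : R} (hβ : β ≠ 0)
    {w : Perm (Fin n)} {a b : Fin n} (h : IsLowerOutsideCorner w a b) :
    grothendieck β w = oplus β a b * grothendieck β (cornerPerm w a b) +
      (1 + C β * oplus β a b) * ∑ U ∈ (phi w a b).powerset.erase ∅,
        C β ^ (U.card - 1) * grothendieck β (cyclePerm w a b U) := by
  have h1 := grothendieck_add_of_isTransition β h.isTransition
  have hphi : covers (cornerPerm w a b) a 0 = phi w a b := by
    ext l
    simp [mem_covers, mem_phi]
  have h2 : transitionSum β (grothendieck β) (cornerPerm w a b) a 0 =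
      grothendieck β (cornerPerm w a b) + C β * ∑ U ∈ (phi w a b).powerset.erase ∅,
        C β ^ (U.card - 1) * grothendieck β (cyclePerm w a b U) := by
    rw [transitionSum, hphi, ← Finset.add_sum_erase _ _ (Finset.empty_mem_powerset _),
      Finset.mul_sum]
    congr 1
    · simp
    · refine Finset.sum_congr rfl fun U hU => ?_
      have hpos : 0 < U.card :=
        Finset.card_pos.2 (Finset.nonempty_iff_ne_empty.2 (Finset.ne_of_mem_erase hU))
      rw [← mul_assoc, ← pow_succ', Nat.sub_add_cancel hpos, cyclePerm]
  rw [cornerPerm_mul_swap, cornerPerm_apply, h2] at h1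
  -- By `1 + β (x ⊕ y) = (1 + β x)(1 + β y)`, `h1` is `β` times the claim, up to the term `G_v` on
  -- both sides.
  apply mul_left_cancel₀ (C_ne_zero.2 hβ : (C β : MvPolynomial (Fin n ⊕ Fin n) R) ≠ 0)
  rw [oplus]
  linear_combination h1

/-- The specialization `β = 0`, `y_j ↦ -y_j`. -/
noncomputable def toSchubert : MvPolynomial (Fin n ⊕ Fin n) (Polynomial ℤ) →+*
    MvPolynomial (Fin n ⊕ Fin n) ℤ :=
  eval₂Hom (C.comp (Polynomial.evalRingHom 0)) (Sum.elim x fun j => -y j)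

@[simp] theorem toSchubert_x (i : Fin n) : toSchubert (x i) = x i := by
  simp [toSchubert, x]

@[simp] theorem toSchubert_y (i : Fin n) : toSchubert (y i) = -y i := by
  simp [toSchubert, y]

@[simp] theorem toSchubert_C_X :
    toSchubert (C Polynomial.X : MvPolynomial (Fin n ⊕ Fin n) (Polynomial ℤ)) = 0 := by
  simp [toSchubert]

theorem toSchubert_actX (w : Perm (Fin n))
    (f : MvPolynomial (Fin n ⊕ Fin n) (Polynomial ℤ)) :
    toSchubert (actX w f) = actX w (toSchubert f) := by
  induction f using MvPolynomial.induction_on with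
  | C r => simp [toSchubert, actX]
  | add p q hp hq => rw [actX_add, map_add, map_add, actX_add, hp, hq]
  | mul_X p k hp =>
    rw [actX_mul, map_mul, map_mul, actX_mul, hp]
    congr 1
    rcases k with k | k
    · change toSchubert (actX w (x k)) = actX w (toSchubert (x k))
      simp
    · change toSchubert (actX w (y k)) = actX w (toSchubert (y k))
      rw [actX_y, toSchubert_y, ← neg_one_mul, actX_mul, actX_y]
      simp [actX]

theorem toSchubert_demazure {i j : Fin n} (hij : i ≠ j)
    (f : MvPolynomial (Fin n ⊕ Fin n) (Polynomial ℤ)) :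
    toSchubert (demazure Polynomial.X i j f) = demazure 0 i j (toSchubert f) := by
  symm
  apply demazure_eq_of_mul_eq 0 hij
  have h := congrArg toSchubert (x_sub_x_mul_demazure Polynomial.X i j f)
  simpa [toSchubert_actX] using h

theorem toSchubert_descend (top : MvPolynomial (Fin n ⊕ Fin n) (Polynomial ℤ))
    (w : Perm (Fin n)) :
    toSchubert (descend Polynomial.X top w) = descend 0 (toSchubert top) w := by
  induction hN : ∑ k : Fin n, (k : ℕ) * (w k : ℕ) using Nat.strong_induction_on
    generalizing w with
  | _ N ih =>
  subst hN
  by_cases h : ∃ p : Fin n × Fin n, IsAscent w p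
  · obtain ⟨p, hp⟩ := h
    have hne : p.1 ≠ p.2 := fun e => by
      have := hp.1
      rw [e] at this
      omega
    rw [descend_eq_demazure _ _ w p hp, descend_eq_demazure _ _ w p hp, toSchubert_demazure hne,
      ih _ (sum_mul_swap_lt w p hp) _ rfl]
  · rw [descend, dif_neg h, descend, dif_neg h]

theorem toSchubert_oplus (i j : Fin n) : toSchubert (oplus Polynomial.X i j) = x i - y j := by
  simp [oplus, sub_eq_add_neg]

theorem toSchubert_grothendieck (w : Perm (Fin n)) :
    toSchubert (grothendieck Polynomial.X w) = doubleSchubert w := by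
  rw [grothendieck, toSchubert_descend, map_prod, doubleSchubert]
  simp only [toSchubert_oplus]

/-- The transition formula for double Schubert polynomials. -/
theorem doubleSchubert_transition {w : Perm (Fin n)} {a b : Fin n}
    (h : IsLowerOutsideCorner w a b) :
    (doubleSchubert w : MvPolynomial (Fin n ⊕ Fin n) ℤ) =
      (x a - y b) * doubleSchubert (cornerPerm w a b) +
        ∑ i ∈ phi w a b, doubleSchubert (cornerPerm w a b * swap i a) := by
  have h1 := congrArg toSchubert (grothendieck_transition Polynomial.X_ne_zero h)
  simp only [map_add, map_mul, map_one, map_sum, map_pow, toSchubert_C_X, toSchubert_oplus,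
    toSchubert_grothendieck, zero_mul, add_zero, one_mul] at h1
  rw [h1]
  congr 1
  -- At `β = 0` the coefficient `β^(#U - 1)` is `1` for singletons and `0` for larger sets.
  have hsub : (phi w a b).powersetCard 1 ⊆ (phi w a b).powerset.erase ∅ := by
    intro U hU
    rw [Finset.mem_powersetCard] at hU
    rw [Finset.mem_erase, Finset.mem_powerset]
    refine ⟨?_, hU.1⟩
    rintro rfl
    simp at hU
  rw [← Finset.sum_subset hsub, Finset.powersetCard_one, Finset.sum_map]
  · refine Finset.sum_congr rfl fun i _ => ?_
    simp [cyclePerm, swap_comm a i]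
  · intro U hU hU'
    rw [Finset.mem_erase, Finset.mem_powerset] at hU
    rw [Finset.mem_powersetCard, not_and] at hU'
    have h2 := hU' hU.2
    have h3 : U.card ≠ 0 := fun h => hU.1 (Finset.card_eq_zero.1 h)
    rw [zero_pow (by omega), zero_mul]

end Specialization

end MatrixSchubert

/-! ### The main theorem. -/

theorem mainTheorem7 (n : ℕ) :
    -- the `β`-double Grothendieck polynomials in `ℤ[β][x, y]` are well defined:
    -- the recursion holds at every descent of every permutation
    (grothendieck (Polynomial.X : Polynomial ℤ) (Fin.revPerm : Equiv.Perm (Fin n)) =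
        ∏ p ∈ Finset.univ.filter (fun p : Fin n × Fin n => (p.1 : ℕ) + p.2 + 2 ≤ n),
          oplus Polynomial.X p.1 p.2) ∧
    (∀ (u : Equiv.Perm (Fin n)) (i j : Fin n), (i : ℕ) + 1 = j → u j < u i →
      grothendieck (Polynomial.X : Polynomial ℤ) (u * Equiv.swap i j) =
        demazure Polynomial.X i j (grothendieck Polynomial.X u)) ∧
    ∀ (w : Equiv.Perm (Fin n)) (a b : Fin n), IsLowerOutsideCorner w a b →
      -- transition for `β`-double Grothendieck polynomials
      (grothendieck (Polynomial.X : Polynomial ℤ) w =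
        oplus Polynomial.X a b * grothendieck Polynomial.X (cornerPerm w a b) +
          (1 + MvPolynomial.C Polynomial.X * oplus Polynomial.X a b) *
            ∑ U ∈ (phi w a b).powerset.erase ∅,
              MvPolynomial.C Polynomial.X ^ (U.card - 1) *
                grothendieck Polynomial.X (cyclePerm w a b U)) ∧
      -- double Grothendieck polynomials (`β = -1`)
      (grothendieck (-1 : ℤ) w =
        (x a + y b - x a * y b) * grothendieck (-1 : ℤ) (cornerPerm w a b) +
          (1 - (x a + y b - x a * y b)) *
            ∑ U ∈ (phi w a b).powerset.erase ∅,
              (-1) ^ (U.card - 1) * grothendieck (-1 : ℤ) (cyclePerm w a b U)) ∧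
      -- single Grothendieck polynomials
      (single (grothendieck (-1 : ℤ) w) =
        MvPolynomial.X a * single (grothendieck (-1 : ℤ) (cornerPerm w a b)) +
          (1 - MvPolynomial.X a) *
            ∑ U ∈ (phi w a b).powerset.erase ∅,
              (-1) ^ (U.card - 1) * single (grothendieck (-1 : ℤ) (cyclePerm w a b U))) ∧
      -- double Schubert polynomials
      ((doubleSchubert w : MvPolynomial (Fin n ⊕ Fin n) ℤ) =
        (x a - y b) * doubleSchubert (cornerPerm w a b) +
          ∑ i ∈ phi w a b, doubleSchubert (cornerPerm w a b * Equiv.swap i a)) ∧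
      -- single Schubert polynomials
      (single (doubleSchubert w : MvPolynomial (Fin n ⊕ Fin n) ℤ) =
        MvPolynomial.X a * single (doubleSchubert (cornerPerm w a b)) +
          ∑ i ∈ phi w a b, single (doubleSchubert (cornerPerm w a b * Equiv.swap i a))) := by
  refine ⟨?_, isDescending_grothendieck _, fun w a b h => ?_⟩
  · apply grothendieck_of_forall_not_isAscent
    rintro ⟨p, h1, h2⟩
    simp only [Fin.revPerm_apply, Fin.rev_lt_rev] at h2
    rw [Fin.lt_def] at h2
    omega
  have hy : ∀ j : Fin n, single (y j : MvPolynomial (Fin n ⊕ Fin n) ℤ) = 0 := fun j => by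
    simp [single, y]
  have hx : ∀ i : Fin n, single (x i : MvPolynomial (Fin n ⊕ Fin n) ℤ) = MvPolynomial.X i :=
    fun i => by simp [single, x]
  -- The formula holds over any domain with `β ≠ 0`, so `β = -1` is taken in `ℤ` directly.
  have hG := grothendieck_transition (β := (-1 : ℤ)) (by norm_num) h
  have hS := doubleSchubert_transition h
  have hG' : grothendieck (-1 : ℤ) w =
      (x a + y b - x a * y b) * grothendieck (-1 : ℤ) (cornerPerm w a b) +
        (1 - (x a + y b - x a * y b)) *
          ∑ U ∈ (phi w a b).powerset.erase ∅,
            (-1) ^ (U.card - 1) * grothendieck (-1 : ℤ) (cyclePerm w a b U) := by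
    rw [hG, oplus]
    simp only [map_neg, map_one]
    ring
  refine ⟨grothendieck_transition Polynomial.X_ne_zero h, hG', ?_, hS, ?_⟩
  · rw [hG']
    simp [hx, hy]
  · rw [hS]
    simp [hx, hy]
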